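/- For an irrational real number $\xi$, let $$\ell(\xi):=\limsup_{|p|,q\to\infty}\frac{1}{|q(q\xi-p)|}\in[0,\infty]$$ be its best constant of Diophantine approximation, where $p$ runs over the integers and $q$ over the positive integers, and let $$L:=\{\ell(\xi):\xi\in\mathbb{R}\setminus\mathbb{Q},\ \ell(\xi)<\infty\}\subset\mathbb{R}$$ be the Lagrange spectrum. Let $HD(X)$ denote the Hausdorff dimension of a set $X\subset\mathbb{R}$, and put $d(t):=HD(L\cap(-\infty,t))\in[0,1]$ for $t\in\mathbb{R}$. **Corollary (Moreira).** The function $d:\mathbb{R}\to[0,1]$ is not $\alpha$-Hölder continuous for any $\alpha>0$; that is, for every real $\alpha>0$ there is no constant $C>0$ such that $|d(t)-d(t')|\le C|t-t'|^{\alpha}$ for all $t,t'\in\mathbb{R}$. -/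

import Mathlib

open Filter Set
open scoped NNReal

/-- The best constant of Diophantine approximation of `α`: the limit superior of
`1 / |q (q α - p)|` over integers `p` and positive integers `q` as `|p| → ∞` and `q → ∞`
(on `ℤ` the filter `cofinite` expresses `|p| → ∞`). It is computed in the extended reals, so that
it may be `+∞`. -/
noncomputable def bestConstant (α : ℝ) : EReal :=
  limsup (fun x : ℤ × ℕ => ((1 / |(x.2 : ℝ) * ((x.2 : ℝ) * α - (x.1 : ℝ))| : ℝ) : EReal))
    (cofinite ×ˢ atTop)

/-- The Lagrange spectrum: the finite best constants of Diophantine approximation of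
irrational numbers. -/
def lagrangeSpectrum : Set ℝ :=
  {x : ℝ | ∃ α : ℝ, Irrational α ∧ bestConstant α = (x : EReal)}

/-- The Hausdorff dimension of a set of real numbers is at most one; in particular it is finite, so
that reading it as a real number loses nothing. -/
theorem dimH_real_le_one (s : Set ℝ) : dimH s ≤ 1 :=
  (dimH_mono (subset_univ s)).trans Real.dimH_univ.le

/-- The function `t ↦ HD(L ∩ (-∞, t))`, where `L` is the Lagrange spectrum. -/
noncomputable def lagrangeDim (t : ℝ) : ℝ :=
  (dimH (lagrangeSpectrum ∩ Iio t)).toReal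

/-!
Just above `3` the function `d` rises too steeply for a Hölder condition.

By Markov's theorem a best constant `< 3` forces the continued fraction digits to be eventually
periodic, so `L ∩ (-∞, 3)` is countable and `d(3) = 0`. On the other hand `d(3 + 4⁻ⁿ) ≥ c / n`.
Take continued fractions made of the blocks `1^{2k} 22` with the runs `k` all in
`{2n+3, 2n+4}` except for a sparse marked run `n`, placed symmetrically around ever rarer marks;
the best constant is then the limiting value at the marks, which is less than `3 + 4⁻ⁿ`. The free
runs code a binary sequence, and two sequences that first differ at place `j` give values at
distance at least `9^{-(2n+7)(j+1)}`, whence a set of dimension at least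
`log 2 / ((2n+7) log 9)`. Finally `c / n` is not `O(4^{-αn})` for any `α > 0`.
-/

open scoped Topology

/-! ### Continued fractions and the best constant -/

/-- `IsCF ξ a d r` says that `ξ = a + r 0` has the regular continued fraction
`[a; d 0, d 1, …]`, with complete quotients `r k = [0; d k, d (k + 1), …]`. -/
structure IsCF (ξ : ℝ) (a : ℤ) (d : ℕ → ℕ) (r : ℕ → ℝ) : Prop where
  base : ξ = a + r 0
  pos : ∀ k, 0 < r k
  lt_one : ∀ k, r k < 1
  step : ∀ k, 1 / r k = d k + r (k + 1)

/-- The finite continued fraction `[0; d (k - 1), …, d 0]`, read leftwards from position `k`. -/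
noncomputable def cfLeft (d : ℕ → ℕ) : ℕ → ℝ
  | 0 => 0
  | k + 1 => 1 / (d k + cfLeft d k)

/-- Denominators of the convergents, shifted by one index: they start with `0, 1`, so that
`cfDen d (k + 1)` is the denominator of `[a; d 0, …, d (k - 1)]`. -/
def cfDen (d : ℕ → ℕ) : ℕ → ℤ
  | 0 => 0
  | 1 => 1
  | k + 2 => d k * cfDen d (k + 1) + cfDen d k

/-- Numerators of the convergents, shifted as in `cfDen`: they start with `1, a`. -/
def cfNum (a : ℤ) (d : ℕ → ℕ) : ℕ → ℤ
  | 0 => 1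
  | 1 => a
  | k + 2 => d k * cfNum a d (k + 1) + cfNum a d k

/-- The value `1 / |q (q ξ - p)|` at the convergent `p / q = [a; d 0, …, d (k - 1)]`, see
`IsCF.one_div_eq_cfValue`. -/
noncomputable def cfValue (d : ℕ → ℕ) (r : ℕ → ℝ) (k : ℕ) : ℝ :=
  d k + r (k + 1) + cfLeft d k

theorem cfDen_mul_cfNum_sub (a : ℤ) (d : ℕ → ℕ) (k : ℕ) :
    cfDen d (k + 1) * cfNum a d k - cfDen d k * cfNum a d (k + 1) = (-1) ^ k := by
  induction k with
  | zero => simp [cfDen, cfNum]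
  | succ k ih =>
    simp only [cfDen, cfNum]
    rw [pow_succ, ← ih]
    ring

theorem exists_eq_cfNum_cfDen_combination (a : ℤ) (d : ℕ → ℕ) (k : ℕ) (p q : ℤ) :
    ∃ x y : ℤ, p = x * cfNum a d k + y * cfNum a d (k + 1) ∧
      q = x * cfDen d k + y * cfDen d (k + 1) := by
  have hdet := cfDen_mul_cfNum_sub a d k
  have hsq : ((-1 : ℤ) ^ k) * (-1) ^ k = 1 := by rw [← mul_pow]; simp
  refine ⟨(-1) ^ k * (cfDen d (k + 1) * p - cfNum a d (k + 1) * q),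
    (-1) ^ k * (cfNum a d k * q - cfDen d k * p), ?_, ?_⟩
  · linear_combination (-p) * hsq - (-1) ^ k * p * hdet
  · linear_combination (-q) * hsq - (-1) ^ k * q * hdet

theorem cfLeft_nonneg (d : ℕ → ℕ) (k : ℕ) : 0 ≤ cfLeft d k := by
  induction k with
  | zero => exact le_rfl
  | succ k ih => simp only [cfLeft]; positivity

namespace IsCF

variable {ξ : ℝ} {a : ℤ} {d : ℕ → ℕ} {r : ℕ → ℝ}

theorem tail_mul (h : IsCF ξ a d r) (k : ℕ) : r k * (d k + r (k + 1)) = 1 := by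
  rw [← h.step, mul_one_div_cancel (h.pos k).ne']

theorem one_le_digit (h : IsCF ξ a d r) (k : ℕ) : 1 ≤ d k := by
  have hgt : 1 < 1 / r k := (one_lt_div (h.pos k)).2 (h.lt_one k)
  have hpos : (0 : ℝ) < d k := by linarith [h.step k, h.lt_one (k + 1)]
  exact_mod_cast hpos

theorem one_le_digit_cast (h : IsCF ξ a d r) (k : ℕ) : (1 : ℝ) ≤ d k := by
  exact_mod_cast h.one_le_digit k

theorem cfDen_nonneg_and_pos (h : IsCF ξ a d r) (k : ℕ) : 0 ≤ cfDen d k ∧ 0 < cfDen d (k + 1) := by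
  induction k with
  | zero => simp [cfDen]
  | succ k ih =>
    have hd : (0 : ℤ) < d k := by exact_mod_cast h.one_le_digit k
    exact ⟨ih.2.le, add_pos_of_pos_of_nonneg (mul_pos hd ih.2) ih.1⟩

theorem cfDen_nonneg (h : IsCF ξ a d r) (k : ℕ) : 0 ≤ cfDen d k := (h.cfDen_nonneg_and_pos k).1

theorem cfDen_pos (h : IsCF ξ a d r) (k : ℕ) : 0 < cfDen d (k + 1) := (h.cfDen_nonneg_and_pos k).2

theorem cfDen_cast_pos (h : IsCF ξ a d r) (k : ℕ) : (0 : ℝ) < cfDen d (k + 1) := by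
  exact_mod_cast h.cfDen_pos k

theorem cfDen_add_le (h : IsCF ξ a d r) (k : ℕ) :
    cfDen d (k + 1) + cfDen d k ≤ cfDen d (k + 2) := by
  have hd : (1 : ℤ) ≤ d k := by exact_mod_cast h.one_le_digit k
  exact add_le_add_left (le_mul_of_one_le_left (h.cfDen_nonneg _) hd) _

theorem le_cfDen (h : IsCF ξ a d r) (k : ℕ) : (k : ℤ) ≤ cfDen d (k + 1) := by
  induction k with
  | zero => simp [cfDen]
  | succ k ih =>
    rcases k with _ | k
    · exact h.cfDen_pos 1
    · push_cast at ih ⊢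
      linarith [h.cfDen_add_le (k + 1), h.cfDen_pos k]

theorem tendsto_cfDen (h : IsCF ξ a d r) :
    Tendsto (fun k => (cfDen d (k + 1) : ℝ)) atTop atTop :=
  tendsto_atTop_mono (fun k => by exact_mod_cast h.le_cfDen k) tendsto_natCast_atTop_atTop

theorem cfLeft_eq_div (h : IsCF ξ a d r) (k : ℕ) :
    cfLeft d k = cfDen d k / cfDen d (k + 1) := by
  induction k with
  | zero => simp [cfLeft, cfDen]
  | succ k ih =>
    have hpos := h.cfDen_cast_pos k
    simp only [cfLeft, ih, cfDen]
    push_cast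
    field_simp

theorem cfLeft_mul (h : IsCF ξ a d r) (k : ℕ) : cfLeft d (k + 1) * (d k + cfLeft d k) = 1 :=
  one_div_mul_cancel (by linarith [h.one_le_digit_cast k, cfLeft_nonneg d k])

theorem cfLeft_succ_pos (h : IsCF ξ a d r) (k : ℕ) : 0 < cfLeft d (k + 1) :=
  one_div_pos.2 (by linarith [h.one_le_digit_cast k, cfLeft_nonneg d k])

theorem cfLeft_le_one (h : IsCF ξ a d r) (k : ℕ) : cfLeft d k ≤ 1 := by
  rcases k with _ | k
  · exact zero_le_one
  · exact (div_le_one (by linarith [h.one_le_digit_cast k, cfLeft_nonneg d k])).2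
      (by linarith [h.one_le_digit_cast k, cfLeft_nonneg d k])

theorem one_le_cfValue (h : IsCF ξ a d r) (k : ℕ) : 1 ≤ cfValue d r k := by
  rw [cfValue]
  linarith [h.one_le_digit_cast k, h.pos (k + 1), cfLeft_nonneg d k]

theorem cfDen_mul_sub_cfNum_succ (h : IsCF ξ a d r) (k : ℕ) :
    (cfDen d (k + 1) * ξ - cfNum a d (k + 1) : ℝ) = -r k * (cfDen d k * ξ - cfNum a d k) := by
  induction k with
  | zero => simp [cfDen, cfNum, h.base]
  | succ k ih =>
    simp only [cfDen, cfNum] at ih ⊢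
    push_cast
    linear_combination (d k + r (k + 1)) * ih -
      (cfDen d k * ξ - cfNum a d k) * h.tail_mul k

theorem cfDen_mul_sub_cfNum_ne_zero (h : IsCF ξ a d r) (k : ℕ) :
    (cfDen d k * ξ - cfNum a d k : ℝ) ≠ 0 := by
  induction k with
  | zero => simp [cfDen, cfNum]
  | succ k ih =>
    rw [h.cfDen_mul_sub_cfNum_succ]
    exact mul_ne_zero (neg_ne_zero.2 (h.pos k).ne') ih

theorem cfDen_mul_sub_cfNum_mul_cfValue (h : IsCF ξ a d r) (k : ℕ) :
    cfDen d (k + 1) * (cfDen d (k + 1) * ξ - cfNum a d (k + 1)) * cfValue d r k = (-1) ^ k := by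
  have hpos := h.cfDen_cast_pos k
  have hdet : (cfDen d (k + 1) * cfNum a d k - cfDen d k * cfNum a d (k + 1) : ℝ) = (-1) ^ k := by
    exact_mod_cast cfDen_mul_cfNum_sub a d k
  rw [cfValue, h.cfLeft_eq_div, ← hdet]
  field_simp
  linear_combination ((d k + r (k + 1)) * cfDen d (k + 1)) * h.cfDen_mul_sub_cfNum_succ k -
    cfDen d (k + 1) * (cfDen d k * ξ - cfNum a d k) * h.tail_mul k

theorem one_div_eq_cfValue (h : IsCF ξ a d r) (k : ℕ) :
    1 / |(cfDen d (k + 1) : ℝ) * (cfDen d (k + 1) * ξ - cfNum a d (k + 1))| = cfValue d r k := by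
  have hval : 0 < cfValue d r k := one_pos.trans_le (h.one_le_cfValue k)
  have hmul := congrArg abs (h.cfDen_mul_sub_cfNum_mul_cfValue k)
  rw [abs_mul, abs_of_pos hval, abs_neg_one_pow] at hmul
  exact (eq_one_div_of_mul_eq_one_right hmul).symm

theorem abs_cfDen_mul_sub_cfNum_le (h : IsCF ξ a d r) (k : ℕ) (p : ℤ) {q : ℤ} (hq : 0 < q)
    (hqk : q < cfDen d (k + 2)) :
    |(cfDen d (k + 1) * ξ - cfNum a d (k + 1) : ℝ)| ≤ |q * ξ - p| := by
  obtain ⟨x, y, rfl, rfl⟩ := exists_eq_cfNum_cfDen_combination a d (k + 1) p q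
  have hQ := h.cfDen_pos k
  have hQ' := h.cfDen_pos (k + 1)
  have hr := h.pos (k + 1)
  have hfactor : ((x * cfDen d (k + 1) + y * cfDen d (k + 2) : ℤ) : ℝ) * ξ -
      ((x * cfNum a d (k + 1) + y * cfNum a d (k + 2) : ℤ) : ℝ) =
      (x - y * r (k + 1)) * (cfDen d (k + 1) * ξ - cfNum a d (k + 1)) := by
    push_cast
    linear_combination (y : ℝ) * h.cfDen_mul_sub_cfNum_succ (k + 1)
  -- The bounds on `q` force the two coordinates to have opposite signs.
  have hcoeff : 1 ≤ |(x - y * r (k + 1) : ℝ)| := by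
    rcases lt_trichotomy x 0 with hx | rfl | hx
    · have hy : 0 ≤ y := by by_contra! hy; nlinarith
      have hx' : (x : ℝ) ≤ -1 := by exact_mod_cast Int.le_sub_one_of_lt hx
      have hy' : (0 : ℝ) ≤ y * r (k + 1) := mul_nonneg (by exact_mod_cast hy) hr.le
      exact le_abs.2 (Or.inr (by linarith))
    · have hy : 0 < y := by by_contra! hy; nlinarith
      nlinarith
    · have hy : y ≤ 0 := by by_contra! hy; nlinarith
      have hx' : (1 : ℝ) ≤ x := by exact_mod_cast hx
      have hy' : y * r (k + 1) ≤ 0 := mul_nonpos_of_nonpos_of_nonneg (by exact_mod_cast hy) hr.le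
      exact le_abs.2 (Or.inl (by linarith))
  rw [hfactor, abs_mul]
  exact le_mul_of_one_le_left (abs_nonneg _) hcoeff

theorem one_div_le_cfValue (h : IsCF ξ a d r) {k : ℕ} (p : ℤ) {q : ℤ} (hq : cfDen d (k + 1) ≤ q)
    (hqk : q < cfDen d (k + 2)) : 1 / |(q : ℝ) * (q * ξ - p)| ≤ cfValue d r k := by
  have hpos := h.cfDen_cast_pos k
  have hle : (cfDen d (k + 1) : ℝ) ≤ q := by exact_mod_cast hq
  rw [← h.one_div_eq_cfValue k]
  refine one_div_le_one_div_of_le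
    (abs_pos.2 (mul_ne_zero hpos.ne' (h.cfDen_mul_sub_cfNum_ne_zero (k + 1)))) ?_
  rw [abs_mul, abs_mul, abs_of_pos hpos, abs_of_pos (hpos.trans_le hle)]
  exact mul_le_mul hle (h.abs_cfDen_mul_sub_cfNum_le k p ((h.cfDen_pos k).trans_le hq) hqk)
    (abs_nonneg _) (hpos.le.trans hle)

theorem exists_cfDen_le_lt (h : IsCF ξ a d r) {K : ℕ} {q : ℤ} (hq : cfDen d (K + 1) ≤ q) :
    ∃ k, K ≤ k ∧ cfDen d (k + 1) ≤ q ∧ q < cfDen d (k + 2) := by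
  by_contra! hall
  have hbounded : ∀ k, K ≤ k → cfDen d (k + 1) ≤ q := fun k hk =>
    Nat.le_induction hq (fun k hk ih => hall k hk ih) k hk
  have hlarge := h.le_cfDen (K + (q.toNat + 1))
  have := hbounded (K + (q.toNat + 1)) (by omega)
  omega

theorem cfDen_mul_abs_le_one (h : IsCF ξ a d r) (k : ℕ) :
    cfDen d (k + 1) * |(cfDen d (k + 1) * ξ - cfNum a d (k + 1) : ℝ)| ≤ 1 := by
  have hmul := congrArg abs (h.cfDen_mul_sub_cfNum_mul_cfValue k)
  rw [abs_mul, abs_mul, abs_of_pos (h.cfDen_cast_pos k), abs_neg_one_pow] at hmul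
  rw [← hmul]
  exact le_mul_of_one_le_right (mul_nonneg (h.cfDen_cast_pos k).le (abs_nonneg _))
    ((h.one_le_cfValue k).trans (le_abs_self _))

theorem tendsto_cfDen_mul_sub_cfNum (h : IsCF ξ a d r) :
    Tendsto (fun k => (cfDen d (k + 1) * ξ - cfNum a d (k + 1) : ℝ)) atTop (𝓝 0) := by
  refine squeeze_zero_norm (fun k => ?_) h.tendsto_cfDen.inv_tendsto_atTop
  rw [Pi.inv_apply, ← one_div, le_div_iff₀' (h.cfDen_cast_pos k)]
  exact h.cfDen_mul_abs_le_one k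

theorem tendsto_cfNum_div_cfDen (h : IsCF ξ a d r) :
    Tendsto (fun k => (cfNum a d (k + 1) / cfDen d (k + 1) : ℝ)) atTop (𝓝 ξ) := by
  have herr := h.tendsto_cfDen_mul_sub_cfNum.mul h.tendsto_cfDen.inv_tendsto_atTop
  have hlim := (tendsto_const_nhds (x := ξ)).sub herr
  rw [zero_mul, sub_zero] at hlim
  refine hlim.congr fun k => ?_
  have := (h.cfDen_cast_pos k).ne'
  simp only [Pi.inv_apply]
  field_simp
  ring

theorem eq_of_digits {ξ' : ℝ} {r' : ℕ → ℝ} (h : IsCF ξ a d r) (h' : IsCF ξ' a d r') : ξ = ξ' :=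
  tendsto_nhds_unique h.tendsto_cfNum_div_cfDen h'.tendsto_cfNum_div_cfDen

theorem irrational (h : IsCF ξ a d r) : Irrational ξ := by
  rintro ⟨x, rfl⟩
  have hden : (0 : ℝ) < x.den := by exact_mod_cast x.den_pos
  have hsmall := h.tendsto_cfDen_mul_sub_cfNum.abs.eventually_lt_const
    (show |(0 : ℝ)| < 1 / x.den by simpa using hden)
  obtain ⟨k, hk⟩ := hsmall.exists
  have hint : ((cfDen d (k + 1) * x.num - cfNum a d (k + 1) * x.den : ℤ) : ℝ) =
      x.den * (cfDen d (k + 1) * x - cfNum a d (k + 1)) := by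
    have hx : (x.den * x : ℝ) = x.num := by exact_mod_cast Rat.den_mul_eq_num x
    push_cast
    linear_combination -(cfDen d (k + 1) : ℝ) * hx
  have hne : cfDen d (k + 1) * x.num - cfNum a d (k + 1) * x.den ≠ 0 := by
    rw [← Int.cast_ne_zero (α := ℝ), hint]
    exact mul_ne_zero hden.ne' (h.cfDen_mul_sub_cfNum_ne_zero (k + 1))
  have hone : (1 : ℝ) ≤ |((cfDen d (k + 1) * x.num - cfNum a d (k + 1) * x.den : ℤ) : ℝ)| := by
    exact_mod_cast Int.one_le_abs hne
  rw [hint, abs_mul, abs_of_pos hden] at hone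
  rw [lt_div_iff₀' hden] at hk
  exact hk.not_ge hone

theorem tendsto_convergent (h : IsCF ξ a d r) :
    Tendsto (fun k => (cfNum a d (k + 1), (cfDen d (k + 1)).toNat)) atTop
      (cofinite ×ˢ (atTop : Filter ℕ)) := by
  refine Tendsto.prodMk ?_ ?_
  · rw [← Filter.cocompact_eq_cofinite, ← Metric.cobounded_eq_cocompact,
      ← tendsto_norm_atTop_iff_cobounded]
    refine (h.tendsto_cfDen.atTop_mul_pos (abs_pos.2 h.irrational.ne_zero)
      h.tendsto_cfNum_div_cfDen.abs).congr fun k => ?_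
    have hpos := h.cfDen_cast_pos k
    rw [abs_div, abs_of_pos hpos, mul_div_cancel₀ _ hpos.ne', Int.norm_eq_abs]
  · refine tendsto_atTop_mono (fun k => ?_) tendsto_id
    have := h.le_cfDen k
    simp only [id]
    omega

theorem bestConstant_eq_limsup (h : IsCF ξ a d r) :
    bestConstant ξ = limsup (fun k => (cfValue d r k : EReal)) atTop := by
  apply le_antisymm
  · refine le_of_forall_gt_imp_ge_of_dense fun B hB => ?_
    obtain ⟨K, hK⟩ := eventually_atTop.1 (eventually_lt_of_limsup_lt hB)
    refine limsup_le_of_le (by isBoundedDefault) ?_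
    have hlarge : ∀ᶠ x : ℤ × ℕ in cofinite ×ˢ atTop, (cfDen d (K + 1)).toNat ≤ x.2 :=
      tendsto_snd.eventually (eventually_ge_atTop _)
    filter_upwards [hlarge] with x hx
    obtain ⟨k, hKk, hq, hqk⟩ := h.exists_cfDen_le_lt (Int.toNat_le.1 hx)
    have hle := h.one_div_le_cfValue x.1 hq hqk
    rw [Int.cast_natCast] at hle
    exact (EReal.coe_le_coe_iff.2 hle).trans (hK k hKk).le
  · refine le_trans (le_of_eq ?_) (limsup_le_limsup_of_le h.tendsto_convergent)
    rw [← limsup_comp]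
    congr! with k
    have hcast : (((cfDen d (k + 1)).toNat : ℕ) : ℝ) = cfDen d (k + 1) := by
      exact_mod_cast Int.toNat_of_nonneg (h.cfDen_pos k).le
    simp only [Function.comp_apply, hcast, h.one_div_eq_cfValue]

end IsCF

theorem exists_isCF_of_irrational {ξ : ℝ} (hξ : Irrational ξ) : ∃ a d r, IsCF ξ a d r := by
  have irrational_fract : ∀ x : ℝ, Irrational x → Irrational (Int.fract x) := fun x hx => by
    rw [← Int.self_sub_floor]
    exact hx.sub_intCast _
  let r : ℕ → ℝ := fun k => Nat.rec (Int.fract ξ) (fun _ x => Int.fract (1 / x)) k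
  have hr : ∀ k, Irrational (r k) ∧ r k ∈ Ico 0 1 := by
    intro k
    induction k with
    | zero => exact ⟨irrational_fract _ hξ, Int.fract_nonneg _, Int.fract_lt_one _⟩
    | succ k ih =>
      refine ⟨irrational_fract _ ?_, Int.fract_nonneg _, Int.fract_lt_one _⟩
      rw [one_div]
      exact ih.1.inv
  refine ⟨⌊ξ⌋, fun k => ⌊1 / r k⌋₊, r, (Int.floor_add_fract ξ).symm,
    fun k => (hr k).2.1.lt_of_ne' (hr k).1.ne_zero, fun k => (hr k).2.2, fun k => ?_⟩
  rw [natCast_floor_eq_intCast_floor (one_div_nonneg.2 (hr k).2.1)]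
  exact (Int.floor_add_fract _).symm

theorem exists_backward_orbit {X : Type*} [TopologicalSpace X] [CompactSpace X] [T2Space X]
    [Nonempty X] (f : ℕ → X → X) (hf : ∀ k, Continuous (f k)) :
    ∃ r : ℕ → X, ∀ k, r k = f k (r (k + 1)) := by
  let S : ℕ → Set (ℕ → X) := fun n => {r | ∀ k < n, r k = f k (r (k + 1))}
  have hnonempty : ∀ n, ∀ g : ℕ → X → X, ∃ r : ℕ → X, ∀ k < n, r k = g k (r (k + 1)) := by
    intro n
    induction n with
    | zero => exact fun _ => ⟨fun _ => Classical.arbitrary X, by simp⟩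
    | succ n ih =>
      intro g
      obtain ⟨r, hr⟩ := ih fun k => g (k + 1)
      refine ⟨fun k => k.casesOn (g 0 (r 0)) r, fun k hk => ?_⟩
      cases k with
      | zero => rfl
      | succ k => exact hr k (by omega)
  have hclosed : ∀ n, IsClosed (S n) := fun n => by
    simp only [S, ofPred_forall]
    exact isClosed_iInter fun k => isClosed_iInter fun _ =>
      isClosed_eq (continuous_apply k) ((hf k).comp (continuous_apply (k + 1)))
  obtain ⟨r, hr⟩ := IsCompact.nonempty_iInter_of_sequence_nonempty_isCompact_isClosed S
    (fun n r hr k hk => hr k (by omega)) (fun n => hnonempty n f)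
    (hclosed 0).isCompact hclosed
  exact ⟨r, fun k => mem_iInter.1 hr (k + 1) k (by omega)⟩

theorem exists_isCF_of_digits {d : ℕ → ℕ} (hd : ∀ k, 1 ≤ d k) :
    ∃ r : ℕ → ℝ, IsCF (r 0) 0 d r := by
  have hd' : ∀ k, (1 : ℝ) ≤ d k := fun k => by exact_mod_cast hd k
  have hpos : ∀ k (x : Icc (0 : ℝ) 1), (0 : ℝ) < d k + x := fun k x => by
    linarith [hd' k, x.2.1]
  obtain ⟨r, hr⟩ := exists_backward_orbit (X := Icc (0 : ℝ) 1)
    (fun k x => ⟨1 / (d k + x), (one_div_pos.2 (hpos k x)).le,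
      (div_le_one (hpos k x)).2 (by linarith [hd' k, x.2.1])⟩)
    (fun k => by
      refine Continuous.subtype_mk (continuous_const.div (by fun_prop) fun x => ?_) _
      exact (hpos k x).ne')
  have hr' : ∀ k, (r k : ℝ) = 1 / (d k + r (k + 1)) := fun k => congrArg Subtype.val (hr k)
  have hr0 : ∀ k, (0 : ℝ) < r k := fun k => by rw [hr' k]; exact one_div_pos.2 (hpos k _)
  refine ⟨fun k => r k, by simp, hr0, fun k => ?_, fun k => ?_⟩
  · rw [hr' k, div_lt_one (hpos k _)]
    linarith [hd' k, hr0 (k + 1)]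
  · rw [hr' k, one_div_one_div]

/-! ### Markov's combinatorial condition -/

/-- Eventual periodicity of a sequence. -/
def EventuallyPeriodic {A : Type*} (w : ℕ → A) : Prop :=
  ∃ K p, 0 < p ∧ ∀ i, K ≤ i → w (i + p) = w i

/-- Markov's condition on a two-letter word, from position `K` on: whenever the letter of `w`
changes between `i` and `i + 1`, the words read leftwards from `i - 1` and rightwards from `i + 2`
agree for `n < N` letters, and then carry the letters `w (i + 1)` and `w i` respectively. -/
def MarkovWord (N : ℕ) (w : ℕ → Bool) (K : ℕ) : Prop :=
  ∀ i, K ≤ i → w i ≠ w (i + 1) → ∃ n < N, (∀ j < n, w (i - 1 - j) = w (i + 2 + j)) ∧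
    w (i - 1 - n) = w (i + 1) ∧ w (i + 2 + n) = w i

theorem countable_eventuallyPeriodic (A : Type*) [Countable A] :
    {w : ℕ → A | EventuallyPeriodic w}.Countable := by
  have hsub : {w : ℕ → A | EventuallyPeriodic w} ⊆
      ⋃ K : ℕ, ⋃ p : ℕ, {w : ℕ → A | 0 < p ∧ ∀ i, K ≤ i → w (i + p) = w i} := by
    rintro w ⟨K, p, hp⟩
    exact mem_iUnion.2 ⟨K, mem_iUnion.2 ⟨p, hp⟩⟩
  refine Countable.mono hsub (countable_iUnion fun K => countable_iUnion fun p => ?_)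
  refine MapsTo.countable_of_injOn (f := fun w (i : Fin (K + p)) => w i) (t := univ)
    (fun _ _ => mem_univ _) ?_ (to_countable _)
  rintro w ⟨hp, hw⟩ w' ⟨_, hw'⟩ heq
  funext i
  induction i using Nat.strong_induction_on with
  | _ i ih =>
  rcases Nat.lt_or_ge i (K + p) with hi | hi
  · exact congrFun heq ⟨i, hi⟩
  · have hi' : i - p + p = i := by omega
    rw [← hi', hw _ (by omega), hw' _ (by omega)]
    exact ih _ (by omega)

theorem exists_last_lt {P : ℕ → Prop} {p q : ℕ} (hpq : p < q) (hp : P p) :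
    ∃ m, p ≤ m ∧ m < q ∧ P m ∧ ∀ j, m < j → j < q → ¬ P j := by
  classical
  refine ⟨Nat.findGreatest P (q - 1), Nat.le_findGreatest (by omega) hp, ?_,
    Nat.findGreatest_spec (show p ≤ q - 1 by omega) hp, fun j hmj hjq => ?_⟩
  · have := Nat.findGreatest_le (P := P) (q - 1)
    omega
  · exact Nat.findGreatest_is_greatest hmj (by omega)

theorem eq_iff_mod_two_eq_of_alternating {w : ℕ → Bool} {p q : ℕ}
    (halt : ∀ j, p ≤ j → j < q → w j ≠ w (j + 1)) {i j : ℕ} (hpi : p ≤ i) (hiq : i ≤ q)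
    (hpj : p ≤ j) (hjq : j ≤ q) : w i = w j ↔ i % 2 = j % 2 := by
  have hbase : ∀ i, p ≤ i → i ≤ q → (w i = w p ↔ i % 2 = p % 2) := by
    intro i hi
    induction i, hi using Nat.le_induction with
    | base => simp
    | succ i hi ih =>
      intro hiq
      have hflip : w (i + 1) = !w i := Bool.eq_not.2 (halt i hi hiq).symm
      have := ih (by omega)
      rw [hflip, Bool.not_eq, Ne, this]
      omega
  have hi := hbase i hpi hiq
  have hj := hbase j hpj hjq
  generalize w i = x, w j = y, w p = z at hi hj
  cases x <;> cases y <;> cases z <;> simp at hi hj ⊢ <;> omega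

namespace MarkovWord

variable {N K : ℕ} {w : ℕ → Bool}

theorem exists_mirrored_alternation (h : MarkovWord N w K) {p q : ℕ} (hKp : K ≤ p) (hpq : p < q)
    (hp : w p = w (p + 1)) (hq : w q = w (q + 1))
    (halt : ∀ j, p + 1 ≤ j → j < q → w j ≠ w (j + 1)) (heven : (q - p) % 2 = 0) :
    ∃ t, 0 < t ∧ t % 2 = 0 ∧ t + 2 ≤ q - p ∧ (∀ j < t, w (q + 1 + j) = w (q - 2 - j)) ∧
      w (q + 1 + t) ≠ w q := by
  have hpne : w p ≠ w q := by
    rw [hp, Ne, eq_iff_mod_two_eq_of_alternating halt le_rfl (by omega) (by omega) le_rfl]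
    omega
  have hlast : w (q - 1) ≠ w q := by
    rw [Ne, eq_iff_mod_two_eq_of_alternating halt (by omega) (by omega) (by omega) le_rfl]
    omega
  obtain ⟨n, -, hagree, hleft, hright⟩ := h (q - 1) (by omega) (by
    rwa [Nat.sub_add_cancel (by omega)])
  rw [Nat.sub_add_cancel (by omega), Nat.sub_sub q 1 1] at hleft
  replace hagree : ∀ j < n, w (q + 1 + j) = w (q - 2 - j) := fun j hj => by
    rw [show q + 1 + j = q - 1 + 2 + j by omega, ← hagree j hj, Nat.sub_sub q 1 1]
  rw [show q - 1 + 2 + n = q + 1 + n by omega] at hright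
  have hn0 : n ≠ 0 := by
    rintro rfl
    exact hlast (hright.symm.trans hq.symm)
  rcases lt_trichotomy n (q - p - 2) with hn | rfl | hn
  · have := (eq_iff_mod_two_eq_of_alternating halt (by omega) (by omega) (by omega) le_rfl).1 hleft
    exact ⟨n, by omega, by omega, by omega, hagree, hright ▸ hlast⟩
  · exact absurd (hleft ▸ congrArg w (by omega)) hpne
  · have hend : w (q + 1 + (q - p - 2)) ≠ w q := by
      rwa [hagree _ hn, show q - 2 - (q - p - 2) = p by omega]
    have hpos : q - p - 2 ≠ 0 := fun hzero => hend (by rw [hzero, hq, add_zero])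
    exact ⟨q - p - 2, by omega, by omega, by omega, fun j hj => hagree j (by omega), hend⟩

/-- Markov's condition at the last change of letter reflects the alternating word
`w (p + 1) ⋯ w q` into a shorter one between opposite squares: infinite descent. -/
theorem no_opposite_squares (h : MarkovWord N w K) {p q : ℕ} (hKp : K ≤ p) (hpq : p < q)
    (hp : w p = w (p + 1)) (hq : w q = w (q + 1))
    (halt : ∀ j, p + 1 ≤ j → j < q → w j ≠ w (j + 1)) (heven : (q - p) % 2 = 0) : False := by
  induction hL : q - p using Nat.strong_induction_on generalizing p q with
  | _ L ih =>
  obtain ⟨t, htpos, hteven, htL, hmirror, hend⟩ :=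
    h.exists_mirrored_alternation hKp hpq hp hq halt heven
  have hne : w (q + t) ≠ w q := by
    rw [show q + t = q + 1 + (t - 1) by omega, hmirror _ (by omega), Ne,
      eq_iff_mod_two_eq_of_alternating halt (by omega) (by omega) (by omega) le_rfl]
    omega
  rw [show q + 1 + t = q + t + 1 by omega] at hend
  refine ih t (by omega) (p := q) (q := q + t) (by omega) (by omega) hq
    ((Bool.eq_not.2 hne).trans (Bool.eq_not.2 hend).symm) (fun j hj hjt => ?_) (by omega) (by omega)
  obtain ⟨l, rfl⟩ := Nat.exists_eq_add_of_le hj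
  rw [hmirror l (by omega), add_assoc, hmirror (l + 1) (by omega), Ne,
    eq_iff_mod_two_eq_of_alternating halt (by omega) (by omega) (by omega) (by omega)]
  omega

theorem square_letter_eq (h : MarkovWord N w K) {p q : ℕ} (hKp : K ≤ p) (hp : w p = w (p + 1))
    (hpq : p ≤ q) (hq : w q = w (q + 1)) : w q = w p := by
  induction q using Nat.strong_induction_on with
  | _ q ih =>
  rcases hpq.eq_or_lt with rfl | hlt
  · rfl
  obtain ⟨m, hpm, hmq, hm, hnone⟩ := exists_last_lt (P := fun j => w j = w (j + 1)) hlt hp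
  rw [← ih m hmq hpm hm]
  by_contra hne
  have halt : ∀ j, m + 1 ≤ j → j < q → w j ≠ w (j + 1) := fun j hj hjq => hnone j hj hjq
  rw [hm, eq_iff_mod_two_eq_of_alternating halt (by omega) le_rfl le_rfl (by omega)] at hne
  exact h.no_opposite_squares (hKp.trans hpm) hmq hm hq halt (by omega)

theorem exists_square_letter (h : MarkovWord N w K) :
    ∃ a s, K ≤ s ∧ w s = a ∧ ∀ i, s ≤ i → w i = w (i + 1) → w i = a := by
  by_cases hsq : ∃ p, K ≤ p ∧ w p = w (p + 1)
  · obtain ⟨p, hKp, hp⟩ := hsq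
    exact ⟨w p, p, hKp, rfl, fun i hi => h.square_letter_eq hKp hp hi⟩
  · push Not at hsq
    exact ⟨w K, K, le_rfl, rfl, fun i hi heq => absurd heq (hsq i hi)⟩

end MarkovWord

/-- Starting positions of the blocks `a`, `a b` into which `w` decomposes from `s` on, when no two
consecutive letters `b` occur. -/
def blockStart (w : ℕ → Bool) (a : Bool) (s : ℕ) : ℕ → ℕ
  | 0 => s
  | i + 1 => blockStart w a s i + (if w (blockStart w a s i + 1) = a then 1 else 2)

/-- The word of blocks, obtained from `w` by the inverse of the substitution `a ↦ a`, `b ↦ a b`. -/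
def blockWord (w : ℕ → Bool) (a : Bool) (s : ℕ) (i : ℕ) : Bool := w (blockStart w a s i + 1)

section Desubstitution

variable {w : ℕ → Bool} {a : Bool} {s : ℕ}

theorem blockStart_succ (w : ℕ → Bool) (a : Bool) (s i : ℕ) : blockStart w a s (i + 1) =
    blockStart w a s i + (if blockWord w a s i = a then 1 else 2) := rfl

theorem blockStart_add_le (w : ℕ → Bool) (a : Bool) (s i m : ℕ) :
    blockStart w a s i + m ≤ blockStart w a s (i + m) := by
  induction m with
  | zero => rfl
  | succ m ih =>
    rw [← add_assoc i, blockStart_succ]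
    split_ifs <;> omega

theorem add_le_blockStart (w : ℕ → Bool) (a : Bool) (s i : ℕ) : s + i ≤ blockStart w a s i := by
  simpa [blockStart] using blockStart_add_le w a s 0 i

theorem apply_blockStart (hs : w s = a) (hsq : ∀ i, s ≤ i → w i = w (i + 1) → w i = a) (i : ℕ) :
    w (blockStart w a s i) = a := by
  induction i with
  | zero => exact hs
  | succ i _ =>
    rw [blockStart]
    split_ifs with hnext
    · exact hnext
    · by_contra hne
      exact hnext (hsq _ (by linarith [add_le_blockStart w a s i])
        ((Bool.eq_not.2 hnext).trans (Bool.eq_not.2 hne).symm))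

theorem apply_blockStart_sub_one (hs : w s = a)
    (hsq : ∀ i, s ≤ i → w i = w (i + 1) → w i = a) (i : ℕ) :
    w (blockStart w a s (i + 1) - 1) = blockWord w a s i := by
  rw [blockStart_succ]
  split_ifs with hnext
  · rw [Nat.add_sub_cancel, hnext]
    exact apply_blockStart hs hsq i
  · rfl

theorem exists_eq_blockStart_or_succ (w : ℕ → Bool) (a : Bool) (s : ℕ) {I k : ℕ}
    (hk : blockStart w a s I ≤ k) :
    ∃ i, I ≤ i ∧ (k = blockStart w a s i ∨ k = blockStart w a s i + 1) := by
  induction k, hk using Nat.le_induction with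
  | base => exact ⟨I, le_rfl, Or.inl rfl⟩
  | succ k _ ih =>
    obtain ⟨i, hi, hstart | hnext⟩ := ih
    · exact ⟨i, hi, Or.inr (by omega)⟩
    · have hsucc := blockStart_succ w a s i
      refine ⟨i + 1, by omega, ?_⟩
      split_ifs at hsucc <;> omega

theorem eventuallyPeriodic_of_blockWord (hs : w s = a)
    (hsq : ∀ i, s ≤ i → w i = w (i + 1) → w i = a)
    (h : EventuallyPeriodic (blockWord w a s)) : EventuallyPeriodic w := by
  obtain ⟨K, p, hp, hper⟩ := h
  obtain ⟨P, hP⟩ := Nat.exists_eq_add_of_le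
    ((Nat.le_add_right _ _).trans (blockStart_add_le w a s K p))
  have hshift : ∀ i, K ≤ i → blockStart w a s (i + p) = blockStart w a s i + P := by
    intro i hi
    induction i, hi using Nat.le_induction with
    | base => exact hP
    | succ i hi ih =>
      rw [add_right_comm, blockStart_succ, hper i hi, blockStart_succ, ih]
      omega
  refine ⟨blockStart w a s K, P, by have := blockStart_add_le w a s K p; omega, fun k hk => ?_⟩
  obtain ⟨i, hi, rfl | rfl⟩ := exists_eq_blockStart_or_succ w a s hk
  · rw [← hshift i hi, apply_blockStart hs hsq, apply_blockStart hs hsq]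
  · rw [add_right_comm, ← hshift i hi]
    exact hper i hi

theorem apply_blockStart_add_two (hs : w s = a) (hsq : ∀ i, s ≤ i → w i = w (i + 1) → w i = a)
    {i : ℕ} (hne : blockWord w a s i ≠ blockWord w a s (i + 1)) :
    w (blockStart w a s i + 2) = blockWord w a s (i + 1) ∧
      blockStart w a s (i + 2) = blockStart w a s i + 3 := by
  have hsucc := blockStart_succ w a s i
  have hsucc' := blockStart_succ w a s (i + 1)
  by_cases hi : blockWord w a s i = a
  · rw [if_pos hi] at hsucc
    have hi' : blockWord w a s (i + 1) ≠ a := fun h => hne (hi.trans h.symm)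
    rw [if_neg hi', hsucc] at hsucc'
    exact ⟨by rw [blockWord, hsucc], hsucc'⟩
  · have hi' : blockWord w a s (i + 1) = a := by
      by_contra hne'
      exact hne ((Bool.eq_not.2 hi).trans (Bool.eq_not.2 hne').symm)
    rw [if_neg hi] at hsucc
    rw [if_pos hi', hsucc] at hsucc'
    rw [hi', ← hsucc]
    exact ⟨apply_blockStart hs hsq (i + 1), hsucc'⟩

theorem exists_reflection_of_blockWord (hs : w s = a)
    (hsq : ∀ i, s ≤ i → w i = w (i + 1) → w i = a) {i i' : ℕ} (j : ℕ) (hji : j ≤ i)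
    (hrefl : ∀ l < j, blockWord w a s (i - 1 - l) = blockWord w a s (i' + l)) :
    ∃ t, j ≤ t ∧ blockStart w a s (i' + j) = blockStart w a s i' + t ∧
      blockStart w a s i = blockStart w a s (i - j) + t ∧
      ∀ t' ≤ t, w (blockStart w a s i - t') = w (blockStart w a s i' + t') := by
  induction j with
  | zero =>
    refine ⟨0, le_rfl, rfl, rfl, fun t' ht' => ?_⟩
    obtain rfl : t' = 0 := by omega
    exact (apply_blockStart hs hsq i).trans (apply_blockStart hs hsq i').symm
  | succ j ih =>
    obtain ⟨t, hjt, hright, hleft, hagree⟩ := ih (by omega) fun l hl => hrefl l (by omega)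
    have hblock := hrefl j (by omega)
    obtain ⟨i₀, rfl⟩ := Nat.exists_eq_add_of_le' hji
    rw [show i₀ + (j + 1) - 1 - j = i₀ by omega] at hblock
    rw [show i₀ + (j + 1) - j = i₀ + 1 by omega] at hleft
    rw [show i₀ + (j + 1) - (j + 1) = i₀ by omega, ← add_assoc i']
    have hstart := blockStart_succ w a s i₀
    have hstart' := blockStart_succ w a s (i' + j)
    have hfirst : w (blockStart w a s (i₀ + (j + 1)) - (t + 1)) =
        w (blockStart w a s i' + (t + 1)) := by
      rw [hleft, show blockStart w a s (i₀ + 1) + t - (t + 1) = blockStart w a s (i₀ + 1) - 1 by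
        omega, apply_blockStart_sub_one hs hsq, hblock, blockWord, hright, add_assoc]
    rw [hblock] at hstart
    refine ⟨t + (if blockWord w a s (i' + j) = a then 1 else 2), by split_ifs <;> omega, by omega,
      by omega, fun t' ht' => ?_⟩
    rcases Nat.lt_or_ge t t' with htt' | htt'
    · rcases (show t' = t + 1 ∨ t' = t + 2 by split_ifs at ht' <;> omega) with rfl | rfl
      · exact hfirst
      · rw [if_neg (by intro heq; rw [if_pos heq] at ht'; omega)] at hstart hstart'
        rw [show blockStart w a s (i₀ + (j + 1)) - (t + 2) = blockStart w a s i₀ by omega,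
          show blockStart w a s i' + (t + 2) = blockStart w a s (i' + j + 1) by omega,
          apply_blockStart hs hsq, apply_blockStart hs hsq]
    · exact hagree t' htt'

theorem MarkovWord.desubstitute {N K : ℕ} (h : MarkovWord (N + 1) w K) (hK : K ≤ s) (hs : w s = a)
    (hsq : ∀ i, s ≤ i → w i = w (i + 1) → w i = a) :
    MarkovWord N (blockWord w a s) (N + 2) := by
  intro i hi hne
  obtain ⟨hnext, hstart⟩ := apply_blockStart_add_two hs hsq hne
  obtain ⟨n, hn, hagree, hleft, hright⟩ := h (blockStart w a s i + 1)
    (by linarith [add_le_blockStart w a s i]) (by rw [hnext]; exact hne)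
  rw [Nat.add_sub_cancel] at hagree hleft
  rw [show blockStart w a s i + 1 + 2 = blockStart w a s (i + 2) by omega] at hagree hright
  rw [hnext] at hleft
  have hdiff : w (blockStart w a s i - n) ≠ w (blockStart w a s (i + 2) + n) := by
    rw [hleft, hright]
    exact hne.symm
  obtain ⟨m, hm, hfirst, hmne⟩ : ∃ m < N + 1,
      (∀ l < m, blockWord w a s (i - 1 - l) = blockWord w a s (i + 2 + l)) ∧
        blockWord w a s (i - 1 - m) ≠ blockWord w a s (i + 2 + m) := by
    by_contra! hall
    have heq : ∀ m < N + 1, blockWord w a s (i - 1 - m) = blockWord w a s (i + 2 + m) := fun m => by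
      induction m using Nat.strong_induction_on with
      | _ m ih => exact fun hm => hall m hm fun l hl => ih l hl (by omega)
    obtain ⟨t, ht, -, -, hmirror⟩ :=
      exists_reflection_of_blockWord hs hsq (N + 1) (by omega) heq
    exact hdiff (hmirror n (by omega))
  obtain ⟨t, hmt, hr, hl, hmirror⟩ := exists_reflection_of_blockWord hs hsq m (by omega) hfirst
  have hlt : t < n := by
    by_contra! hnt
    exact hdiff (hmirror n hnt)
  have hl' : w (blockStart w a s i - (t + 1)) = blockWord w a s (i - 1 - m) := by
    rw [← apply_blockStart_sub_one hs hsq, hl, show i - 1 - m + 1 = i - m by omega]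
    congr 1
    omega
  have hr' : w (blockStart w a s (i + 2) + (t + 1)) = blockWord w a s (i + 2 + m) := by
    rw [blockWord, hr, add_assoc]
  obtain rfl : n = t + 1 := by
    by_contra hnt
    exact hmne (hl'.symm.trans ((hagree (t + 1) (by omega)).trans hr'))
  exact ⟨m, by omega, hfirst, hl'.symm.trans hleft, hr'.symm.trans hright⟩

end Desubstitution

theorem MarkovWord.eventuallyPeriodic {N K : ℕ} {w : ℕ → Bool} (h : MarkovWord N w K) :
    EventuallyPeriodic w := by
  induction N generalizing w K with
  | zero =>
    refine ⟨K, 1, one_pos, fun i hi => ?_⟩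
    by_contra hne
    obtain ⟨n, hn, -⟩ := h i hi (Ne.symm hne)
    omega
  | succ N ih =>
    obtain ⟨a, s, hKs, hs, hsq⟩ := h.exists_square_letter
    exact eventuallyPeriodic_of_blockWord hs hsq (ih (h.desubstitute hKs hs hsq))

/-- The condition on a two-letter sequence `e` (the digits `1`, `2` of a continued fraction), from
position `K` on, forced by a bound below `3` on the approximation constants: no letter is isolated,
and the words on the two sides of each boundary `a a | b b` first differ at a bounded distance `f`,
in the direction that the parity of `f` prescribes. -/
structure BoundaryCondition (e : ℕ → Bool) (N K : ℕ) : Prop where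
  no_isolated : ∀ i, K ≤ i → e i ≠ e (i + 1) → e (i + 1) = e (i + 2)
  boundary : ∀ i, K ≤ i → e (i - 1) = e i → e i ≠ e (i + 1) → e (i + 1) = e (i + 2) →
    ∃ f < N, (∀ j < f, e (i - 2 - j) = e (i + 3 + j)) ∧
      (Even f → e (i - 2 - f) = e (i + 1) ∧ e (i + 3 + f) = e i) ∧
      (¬ Even f → e (i - 2 - f) = e i ∧ e (i + 3 + f) = e (i + 1))

theorem eventuallyPeriodic_of_paired {A : Type*} {e : ℕ → A} (s : ℕ)
    (hpair : ∀ i, e (s + 2 * i + 1) = e (s + 2 * i))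
    (h : EventuallyPeriodic fun i => e (s + 2 * i)) : EventuallyPeriodic e := by
  obtain ⟨K, p, hp, hper⟩ := h
  dsimp only at hper
  refine ⟨s + 2 * K, 2 * p, by omega, fun k hk => ?_⟩
  obtain ⟨i, hi, rfl | rfl⟩ : ∃ i, K ≤ i ∧ (k = s + 2 * i ∨ k = s + 2 * i + 1) :=
    ⟨(k - s) / 2, by omega, by omega⟩
  · rw [← hper i hi, mul_add, add_assoc]
  · rw [hpair, ← hper i hi, ← hpair, mul_add]
    congr 1
    omega

namespace BoundaryCondition

variable {e : ℕ → Bool} {N K : ℕ}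

theorem exists_mirrored_run (h : BoundaryCondition e N K) {p q : ℕ} (hKp : K ≤ p)
    (hp : e p ≠ e (p + 1)) (hrun : ∀ j, p < j → j ≤ q → e j = e q) (hq : e q ≠ e (q + 1))
    (hodd : (q - p) % 2 = 1) : e (q + 1) = e (q + 2) ∧ ∃ t, t % 2 = 1 ∧ t < q - p ∧
      (∀ j, q + 2 < j → j ≤ q + 2 + t → e j = e q) ∧ e (q + 2 + t + 1) ≠ e q := by
  have hlen : q - p ≠ 1 := fun hone => by
    obtain rfl : q = p + 1 := by omega
    exact hq (h.no_isolated p hKp hp)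
  have hpne : e p ≠ e q := by rwa [← hrun (p + 1) (by omega) (by omega)]
  have hnext := h.no_isolated q (by omega) hq
  obtain ⟨f, -, hagree, heven, hodd'⟩ :=
    h.boundary q (by omega) (hrun _ (by omega) (by omega)) hq hnext
  have hmirror : ∀ j, q + 2 < j → j ≤ q + 2 + f → j < q + (q - p) + 1 → e j = e q :=
    fun j hj hjf hjp => by
      rw [show j = q + 3 + (j - (q + 3)) by omega, ← hagree _ (by omega)]
      exact hrun _ (by omega) (by omega)
  refine ⟨hnext, ?_⟩
  rcases lt_trichotomy f (q - p - 2) with hf | rfl | hf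
  · have hfodd : ¬ Even f := fun hfe =>
      hq ((hrun (q - 2 - f) (by omega) (by omega)).symm.trans (heven hfe).1)
    refine ⟨f, Nat.not_even_iff.1 hfodd, by omega,
      fun j hj hjf => hmirror j hj hjf (by omega), ?_⟩
    rw [add_right_comm, (hodd' hfodd).2]
    exact hq.symm
  · exact absurd ((hodd' (Nat.not_even_iff.2 (by omega))).1 ▸ congrArg e (by omega)) hpne
  · refine ⟨q - p - 2, by omega, by omega,
      fun j hj hjf => hmirror j hj (by omega) (by omega), ?_⟩
    rwa [add_right_comm, ← hagree _ hf, show q - 2 - (q - p - 2) = p by omega]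

theorem no_odd_run (h : BoundaryCondition e N K) {p q : ℕ} (hKp : K ≤ p)
    (hp : e p ≠ e (p + 1)) (hrun : ∀ j, p < j → j ≤ q → e j = e q) (hq : e q ≠ e (q + 1))
    (hodd : (q - p) % 2 = 1) : False := by
  induction hM : q - p using Nat.strong_induction_on generalizing p q with
  | _ M ih =>
  obtain ⟨hnext, t, htodd, htM, hmirror, hend⟩ := h.exists_mirrored_run hKp hp hrun hq hodd
  have ht : e (q + 2 + t) = e q := hmirror _ (by omega) le_rfl
  refine ih t (by omega) (p := q + 2) (q := q + 2 + t) (by omega) ?_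
    (fun j hj hjt => (hmirror j hj hjt).trans ht.symm) ?_ (by omega) (by omega)
  · rw [← hnext, hmirror (q + 2 + 1) (by omega) (by omega)]
    exact hq.symm
  · rw [ht]
    exact hend.symm

theorem boundary_mod_two_eq (h : BoundaryCondition e N K) {p q : ℕ} (hKp : K ≤ p) (hpq : p ≤ q)
    (hp : e p ≠ e (p + 1)) (hq : e q ≠ e (q + 1)) : q % 2 = p % 2 := by
  induction q using Nat.strong_induction_on with
  | _ q ih =>
  rcases hpq.eq_or_lt with rfl | hlt
  · rfl
  obtain ⟨m, hpm, hmq, hm, hnone⟩ := exists_last_lt (P := fun j => e j ≠ e (j + 1)) hlt hp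
  have hrun : ∀ j, m < j → j ≤ q → e j = e q := fun j hj hjq => by
    induction hjq using Nat.decreasingInduction with
    | self => rfl
    | of_succ j hjq ih => rw [not_not.1 (hnone j hj hjq), ih (by omega)]
  have := ih m hmq hpm hm
  by_contra hne
  exact h.no_odd_run (hKp.trans hpm) hm hrun hq (by omega)

theorem markovWord_of_paired (h : BoundaryCondition e N K) {s : ℕ} (hKs : K ≤ s)
    (hpair : ∀ i, e (s + 2 * i + 1) = e (s + 2 * i)) :
    MarkovWord N (fun i => e (s + 2 * i)) (N + 2) := by
  intro i hi hne
  dsimp only at hne ⊢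
  obtain ⟨f, hfN, hagree, heven, hodd⟩ := h.boundary (s + 2 * i + 1) (by omega)
    (hpair i).symm (by rwa [hpair]) (hpair (i + 1)).symm
  have hleft : ∀ n < i, e (s + 2 * i + 1 - 2 - 2 * n) = e (s + 2 * (i - 1 - n)) := fun n hn => by
    rw [← hpair]
    congr 1
    omega
  have hleft' : ∀ n < i, e (s + 2 * i + 1 - 2 - (2 * n + 1)) = e (s + 2 * (i - 1 - n)) :=
    fun n hn => by
      congr 1
      omega
  have hright : ∀ n, e (s + 2 * i + 1 + 3 + 2 * n) = e (s + 2 * (i + 2 + n)) := fun n => by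
    congr 1
    omega
  have hright' : ∀ n, e (s + 2 * i + 1 + 3 + (2 * n + 1)) = e (s + 2 * (i + 2 + n)) := fun n => by
    rw [← hpair]
    congr 1
    omega
  rcases f.even_or_odd' with ⟨n, rfl | rfl⟩
  · obtain ⟨hl, hr⟩ := heven (even_two_mul n)
    rw [hleft n (by omega)] at hl
    rw [hright, hpair] at hr
    refine ⟨n, by omega, fun j hj => ?_, hl, hr⟩
    rw [← hleft j (by omega), hagree _ (by omega), hright]
  · obtain ⟨hl, hr⟩ := hodd (by simp)
    have hsame := hagree (2 * n) (by omega)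
    rw [hleft' n (by omega)] at hl
    rw [hright'] at hr
    rw [hleft n (by omega), hright, hl, hr, hpair] at hsame
    exact absurd hsame hne

theorem eventuallyPeriodic (h : BoundaryCondition e N K) : EventuallyPeriodic e := by
  by_cases hconst : ∀ p, K ≤ p → e p = e (p + 1)
  · exact ⟨K, 1, one_pos, fun i hi => (hconst i hi).symm⟩
  push Not at hconst
  obtain ⟨p, hKp, hp⟩ := hconst
  have hpair : ∀ i, e (p + 1 + 2 * i + 1) = e (p + 1 + 2 * i) := fun i => by
    by_contra hne
    have := h.boundary_mod_two_eq hKp (by omega) hp (Ne.symm hne)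
    omega
  exact eventuallyPeriodic_of_paired (p + 1) hpair
    (h.markovWord_of_paired (by omega) hpair).eventuallyPeriodic

end BoundaryCondition

/-! ### Best constants below `3` -/

section ContinuedFractionComparison

variable {u v a : ℕ → ℝ} {n : ℕ}

theorem sub_eq_neg_one_pow_mul_prod (hu : ∀ j < n, u j * (a j + u (j + 1)) = 1)
    (hv : ∀ j < n, v j * (a j + v (j + 1)) = 1) :
    u 0 - v 0 = (-1) ^ n * (∏ j ∈ Finset.range n, u j * v j) * (u n - v n) := by
  induction n with
  | zero => simp
  | succ n ih =>
    have hstep : u n - v n = -(u n * v n) * (u (n + 1) - v (n + 1)) := by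
      linear_combination v n * hu n n.lt_succ_self - u n * hv n n.lt_succ_self
    rw [ih (fun j hj => hu j (by omega)) (fun j hj => hv j (by omega)), hstep,
      Finset.prod_range_succ, pow_succ]
    ring

theorem abs_sub_le_pow_mul {b : ℝ} (hu : ∀ j < n, u j * (a j + u (j + 1)) = 1)
    (hv : ∀ j < n, v j * (a j + v (j + 1)) = 1) (hub : ∀ j < n, u j ∈ Icc 0 b)
    (hvb : ∀ j < n, v j ∈ Icc 0 b) : |u 0 - v 0| ≤ (b * b) ^ n * |u n - v n| := by
  rw [sub_eq_neg_one_pow_mul_prod hu hv, abs_mul, abs_mul, abs_neg_one_pow, one_mul,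
    Finset.abs_prod]
  gcongr
  refine (Finset.prod_le_prod (fun _ _ => abs_nonneg _) fun j hj => ?_).trans_eq
    (Finset.prod_const (b * b) |>.trans (by rw [Finset.card_range]))
  obtain ⟨hu0, hu1⟩ := hub j (Finset.mem_range.1 hj)
  obtain ⟨hv0, hv1⟩ := hvb j (Finset.mem_range.1 hj)
  rw [abs_of_nonneg (mul_nonneg hu0 hv0)]
  exact mul_le_mul hu1 hv1 hv0 (hu0.trans hu1)

theorem lt_iff_even_iff_lt (hu : ∀ j < n, u j * (a j + u (j + 1)) = 1)
    (hv : ∀ j < n, v j * (a j + v (j + 1)) = 1) (hu0 : ∀ j < n, 0 < u j)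
    (hv0 : ∀ j < n, 0 < v j) (hne : u n ≠ v n) : v 0 < u 0 ↔ (Even n ↔ v n < u n) := by
  have hprod : 0 < ∏ j ∈ Finset.range n, u j * v j := Finset.prod_pos fun j hj =>
    mul_pos (hu0 j (Finset.mem_range.1 hj)) (hv0 j (Finset.mem_range.1 hj))
  rw [← sub_pos, sub_eq_neg_one_pow_mul_prod hu hv]
  rcases Nat.even_or_odd n with heven | hodd
  · simp [heven, heven.neg_one_pow, hprod]
  · rw [hodd.neg_one_pow, neg_one_mul, neg_mul, neg_pos, ← not_le,
      mul_nonneg_iff_of_pos_left hprod, not_le, sub_neg]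
    simp only [Nat.not_even_iff_odd.2 hodd, false_iff, not_lt]
    exact ⟨le_of_lt, fun hle => lt_of_le_of_ne hle hne⟩

end ContinuedFractionComparison

theorem sub_le_sub_of_boundary_value_lt {x y B : ℝ} (hx : 0 ≤ x) (hy : 0 ≤ y) (hB : B ≤ 3)
    (h : 3 + 1 / (2 + y) - 1 / (2 + x) < B) : 3 - B ≤ y - x := by
  have hdiff : 1 / (2 + x) - 1 / (2 + y) = (y - x) / ((2 + x) * (2 + y)) := by
    field_simp
    ring
  have hquot : 3 - B < (y - x) / ((2 + x) * (2 + y)) := by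
    rw [← hdiff]
    linarith
  rw [lt_div_iff₀ (by positivity)] at hquot
  have hden : 1 ≤ (2 + x) * (2 + y) := by nlinarith
  nlinarith

namespace IsCF

variable {ξ : ℝ} {a : ℤ} {d : ℕ → ℕ} {r : ℕ → ℝ}

theorem one_third_lt_tail (h : IsCF ξ a d r) {k : ℕ} (hd : d k ≤ 2) : 1 / 3 < r k := by
  have hd' : (d k : ℝ) ≤ 2 := by exact_mod_cast hd
  nlinarith [h.tail_mul k, h.lt_one (k + 1), h.pos k]

theorem one_third_le_cfLeft (h : IsCF ξ a d r) {k : ℕ} (hd : d k ≤ 2) :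
    1 / 3 ≤ cfLeft d (k + 1) := by
  have hd' : (d k : ℝ) ≤ 2 := by exact_mod_cast hd
  nlinarith [h.cfLeft_mul k, h.cfLeft_le_one k, h.cfLeft_succ_pos k]

theorem tail_le_three_quarters (h : IsCF ξ a d r) {k : ℕ} (hd : d (k + 1) ≤ 2) : r k ≤ 3 / 4 := by
  nlinarith [h.tail_mul k, h.pos k, h.one_third_lt_tail hd, h.one_le_digit_cast k]

theorem cfLeft_le_three_quarters (h : IsCF ξ a d r) {k : ℕ} (hd : d k ≤ 2) :
    cfLeft d (k + 2) ≤ 3 / 4 := by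
  nlinarith [h.cfLeft_mul (k + 1), h.cfLeft_succ_pos (k + 1), h.one_third_le_cfLeft hd,
    h.one_le_digit_cast (k + 1)]

theorem cfLeft_sub_mul (h : IsCF ξ a d r) {i j : ℕ} (hj : j < i) :
    cfLeft d (i - j) * (d (i - 1 - j) + cfLeft d (i - (j + 1))) = 1 := by
  obtain ⟨m, rfl⟩ : ∃ m, i = m + 1 + j := ⟨i - 1 - j, by omega⟩
  have hmul := h.cfLeft_mul m
  rwa [show m + 1 + j - j = m + 1 by omega, show m + 1 + j - 1 - j = m by omega,
    show m + 1 + j - (j + 1) = m by omega]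

theorem abs_cfLeft_sub_tail_le (h : IsCF ξ a d r) {K N i i' : ℕ} (hd : ∀ k, K ≤ k → d k ≤ 2)
    (hi : K + N + 1 ≤ i) (hi' : K ≤ i') (hagree : ∀ j < N, d (i - 1 - j) = d (i' + j)) :
    |cfLeft d i - r i'| ≤ (9 / 16 : ℝ) ^ N := by
  have hbound := abs_sub_le_pow_mul (u := fun j => cfLeft d (i - j)) (v := fun j => r (i' + j))
    (a := fun j => d (i - 1 - j)) (b := 3 / 4) (n := N)
    (fun j hj => h.cfLeft_sub_mul (by omega))
    (fun j hj => by simp only [hagree j hj]; exact h.tail_mul (i' + j))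
    (fun j hj => by
      obtain ⟨m, hm⟩ : ∃ m, i - j = m + 2 := ⟨i - j - 2, by omega⟩
      simp only [hm]
      exact ⟨cfLeft_nonneg _ _, h.cfLeft_le_three_quarters (hd m (by omega))⟩)
    (fun j _ => ⟨(h.pos _).le, h.tail_le_three_quarters (hd _ (by omega))⟩)
  have hlast : |cfLeft d (i - N) - r (i' + N)| ≤ 1 :=
    abs_le.2 ⟨by linarith [cfLeft_nonneg d (i - N), h.lt_one (i' + N)],
      by linarith [h.cfLeft_le_one (i - N), h.pos (i' + N)]⟩
  refine hbound.trans ((mul_le_of_le_one_right (by positivity) hlast).trans_eq ?_)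
  norm_num

theorem tail_lt_cfLeft_of_digit_lt (h : IsCF ξ a d r) {i i' : ℕ} (hlt : d i < d i') :
    r i' < cfLeft d (i + 1) := by
  have hlt' : (d i + 1 : ℝ) ≤ d i' := by exact_mod_cast hlt
  nlinarith [h.cfLeft_mul i, h.tail_mul i', h.cfLeft_le_one i, h.pos (i' + 1), h.pos i',
    h.cfLeft_succ_pos i, mul_pos (h.pos i') (h.cfLeft_succ_pos i)]

theorem cfLeft_lt_tail_of_digit_lt (h : IsCF ξ a d r) {i i' : ℕ} (hlt : d i' < d i) :
    cfLeft d (i + 1) < r i' := by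
  have hlt' : (d i' + 1 : ℝ) ≤ d i := by exact_mod_cast hlt
  nlinarith [h.cfLeft_mul i, h.tail_mul i', cfLeft_nonneg d i, h.lt_one (i' + 1), h.pos i',
    h.cfLeft_succ_pos i, mul_pos (h.pos i') (h.cfLeft_succ_pos i)]

theorem tail_lt_cfLeft_iff (h : IsCF ξ a d r) {i i' f : ℕ} (hf : f < i)
    (hagree : ∀ j < f, d (i - 1 - j) = d (i' + j)) (hne : d (i - 1 - f) ≠ d (i' + f)) :
    r i' < cfLeft d i ↔ (Even f ↔ d (i - 1 - f) < d (i' + f)) := by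
  have hsub : i - f = i - 1 - f + 1 := by omega
  have hlt : r (i' + f) < cfLeft d (i - f) ↔ d (i - 1 - f) < d (i' + f) := by
    rw [hsub]
    refine ⟨fun hlt => ?_, h.tail_lt_cfLeft_of_digit_lt⟩
    by_contra! hge
    exact hlt.asymm (h.cfLeft_lt_tail_of_digit_lt (lt_of_le_of_ne hge hne.symm))
  have hne' : cfLeft d (i - f) ≠ r (i' + f) := by
    rw [hsub]
    rcases hne.lt_or_gt with hd | hd
    · exact (h.tail_lt_cfLeft_of_digit_lt hd).ne'
    · exact (h.cfLeft_lt_tail_of_digit_lt hd).ne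
  rw [← hlt]
  refine lt_iff_even_iff_lt (u := fun j => cfLeft d (i - j)) (v := fun j => r (i' + j))
    (a := fun j => d (i - 1 - j)) (fun j hj => h.cfLeft_sub_mul (by omega))
    (fun j hj => by simp only [hagree j hj]; exact h.tail_mul (i' + j))
    (fun j hj => ?_) (fun j _ => h.pos _) hne'
  obtain ⟨m, hm⟩ : ∃ m, i - j = m + 1 := ⟨i - j - 1, by omega⟩
  simp only [hm]
  exact h.cfLeft_succ_pos m

theorem cfValue_of_two_two_one_one (h : IsCF ξ a d r) {i : ℕ} (h0 : d i = 2) (h1 : d (i + 1) = 2)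
    (h2 : d (i + 2) = 1) (h3 : d (i + 3) = 1) :
    cfValue d r (i + 1) = 3 + 1 / (2 + cfLeft d i) - 1 / (2 + r (i + 4)) := by
  have htail2 := h.tail_mul (i + 2)
  have htail3 := h.tail_mul (i + 3)
  rw [h2, Nat.cast_one] at htail2
  rw [h3, Nat.cast_one] at htail3
  have hpos := h.pos (i + 4)
  have hleft := cfLeft_nonneg d i
  simp only [cfValue, cfLeft, h0, h1]
  rw [show i + 1 + 1 = i + 2 by omega, eq_one_div_of_mul_eq_one_left htail2,
    eq_one_div_of_mul_eq_one_left htail3]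
  push_cast
  field_simp
  ring

theorem cfValue_of_one_one_two_two (h : IsCF ξ a d r) {i : ℕ} (h0 : d i = 1) (h1 : d (i + 1) = 1)
    (h2 : d (i + 2) = 2) (h3 : d (i + 3) = 2) :
    cfValue d r (i + 2) = 3 + 1 / (2 + r (i + 4)) - 1 / (2 + cfLeft d i) := by
  have htail := h.tail_mul (i + 3)
  rw [h3, Nat.cast_ofNat] at htail
  have hpos := h.pos (i + 4)
  have hleft := cfLeft_nonneg d i
  simp only [cfValue, cfLeft, h0, h1, h2]
  rw [show i + 2 + 1 = i + 3 by omega, eq_one_div_of_mul_eq_one_left htail]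
  push_cast
  field_simp
  ring

theorem digit_eq_one_or_two (h : IsCF ξ a d r) {k : ℕ} (hk : cfValue d r k < 3) :
    d k = 1 ∨ d k = 2 := by
  rw [cfValue] at hk
  have hlt : (d k : ℝ) < 3 := by linarith [h.pos (k + 1), cfLeft_nonneg d k]
  have hlt' : d k < 3 := by exact_mod_cast hlt
  have := h.one_le_digit k
  omega

theorem three_lt_cfValue_of_two_one_two (h : IsCF ξ a d r) {i : ℕ} (hleft : d i ≤ 2)
    (h0 : d (i + 1) = 2) (h1 : d (i + 2) = 1) (h2 : d (i + 3) = 2) : 3 < cfValue d r (i + 1) := by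
  have htail2 := h.tail_mul (i + 2)
  have htail3 := h.tail_mul (i + 3)
  rw [h1, Nat.cast_one] at htail2
  rw [h2, Nat.cast_ofNat] at htail3
  have hr3 : r (i + 3) < 1 / 2 := by nlinarith [h.pos (i + 3), h.pos (i + 4)]
  have hr2 : 2 / 3 < r (i + 2) := by nlinarith [h.pos (i + 2)]
  rw [cfValue, h0, Nat.cast_ofNat]
  linarith [h.one_third_le_cfLeft hleft]

theorem three_lt_cfValue_of_one_two_one (h : IsCF ξ a d r) {i : ℕ}
    (h0 : d i = 1) (h1 : d (i + 1) = 2) (h2 : d (i + 2) = 1) : 3 < cfValue d r (i + 1) := by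
  have htail := h.tail_mul (i + 2)
  have hleft := h.cfLeft_mul i
  rw [h2, Nat.cast_one] at htail
  rw [h0, Nat.cast_one] at hleft
  have hr : 1 / 2 < r (i + 2) := by nlinarith [h.lt_one (i + 3), h.pos (i + 2)]
  have hl : 1 / 2 ≤ cfLeft d (i + 1) := by
    nlinarith [h.cfLeft_le_one i, h.cfLeft_succ_pos i]
  rw [cfValue, h1, Nat.cast_ofNat]
  linarith

theorem no_isolated_digit (h : IsCF ξ a d r) {K : ℕ} (hK : ∀ k, K ≤ k → cfValue d r k < 3)
    {i : ℕ} (hi : K < i) (hne : d i ≠ d (i + 1)) : d (i + 1) = d (i + 2) := by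
  obtain ⟨j, rfl⟩ : ∃ j, i = j + 1 := ⟨i - 1, by omega⟩
  have hdigit : ∀ k, K ≤ k → d k = 1 ∨ d k = 2 := fun k hk => h.digit_eq_one_or_two (hK k hk)
  by_contra hne'
  simp only [add_assoc, Nat.reduceAdd] at hne hne'
  have hd := hdigit j (by omega)
  have hd0 := hdigit (j + 1) (by omega)
  have hd2 := hdigit (j + 3) (by omega)
  rcases hdigit (j + 2) (by omega) with hd1 | hd1
  · exact (h.three_lt_cfValue_of_two_one_two (by omega) (by omega) hd1 (by omega)).asymm
      (hK (j + 1) (by omega))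
  · have hd0' : d (j + 1) = 1 := by omega
    have hd2' : d (j + 3) = 1 := by omega
    exact (h.three_lt_cfValue_of_one_two_one hd0' hd1 hd2').asymm (hK (j + 2) (by omega))

section BoundedBelowThree

variable {B : ℝ} {K N : ℕ}

theorem boundary_gap (h : IsCF ξ a d r) (hB : B < 3) (hK : ∀ k, K ≤ k → cfValue d r k < B)
    {i : ℕ} (hi : K ≤ i) (h0 : d i = d (i + 1)) (h1 : d (i + 1) ≠ d (i + 2))
    (h2 : d (i + 2) = d (i + 3)) :
    (d i = 2 → 3 - B ≤ cfLeft d i - r (i + 4)) ∧ (d i = 1 → 3 - B ≤ r (i + 4) - cfLeft d i) := by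
  have hleft := cfLeft_nonneg d i
  have hright := (h.pos (i + 4)).le
  have hd2 := h.digit_eq_one_or_two ((hK (i + 2) (by omega)).trans hB)
  constructor <;> intro hd
  · refine sub_le_sub_of_boundary_value_lt hright hleft hB.le ?_
    rw [← h.cfValue_of_two_two_one_one hd (by omega) (by omega) (by omega)]
    exact hK _ (by omega)
  · refine sub_le_sub_of_boundary_value_lt hleft hright hB.le ?_
    rw [← h.cfValue_of_one_one_two_two hd (by omega) (by omega) (by omega)]
    exact hK _ (by omega)

theorem exists_first_difference_at_boundary (h : IsCF ξ a d r) (hB : B < 3)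
    (hN : (9 / 16 : ℝ) ^ N < 3 - B) (hK : ∀ k, K ≤ k → cfValue d r k < B) {i : ℕ}
    (hi : K + N + 1 ≤ i) (h0 : d i = d (i + 1)) (h1 : d (i + 1) ≠ d (i + 2))
    (h2 : d (i + 2) = d (i + 3)) :
    ∃ f < N, (∀ j < f, d (i - 1 - j) = d (i + 4 + j)) ∧ d (i - 1 - f) ≠ d (i + 4 + f) ∧
      (d i = 2 ↔ (Even f ↔ d (i - 1 - f) < d (i + 4 + f))) := by
  have hdigit : ∀ k, K ≤ k → d k = 1 ∨ d k = 2 := fun k hk =>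
    h.digit_eq_one_or_two ((hK k hk).trans hB)
  obtain ⟨hgap2, hgap1⟩ := h.boundary_gap hB hK (by omega : K ≤ i) h0 h1 h2
  have hsign : d i = 2 ↔ r (i + 4) < cfLeft d i := by
    refine ⟨fun hd => by linarith [hgap2 hd], fun hlt => ?_⟩
    exact (hdigit i (by omega)).resolve_left fun hd => by linarith [hgap1 hd]
  have hgap : (9 / 16 : ℝ) ^ N < |cfLeft d i - r (i + 4)| := by
    rcases hdigit i (by omega) with hd | hd
    · exact hN.trans_le (by rw [abs_sub_comm]; exact (hgap1 hd).trans (le_abs_self _))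
    · exact hN.trans_le ((hgap2 hd).trans (le_abs_self _))
  have hdiff : ∃ f, f < N ∧ d (i - 1 - f) ≠ d (i + 4 + f) := by
    by_contra! hagree
    exact hgap.not_ge (h.abs_cfLeft_sub_tail_le (fun k hk => by have := hdigit k hk; omega)
      hi (by omega) hagree)
  classical
  obtain ⟨hfN, hfne⟩ := Nat.find_spec hdiff
  have hagree : ∀ j < Nat.find hdiff, d (i - 1 - j) = d (i + 4 + j) := fun j hj => by
    by_contra hne
    exact Nat.find_min hdiff hj ⟨by omega, hne⟩
  exact ⟨_, hfN, hagree, hfne, hsign.trans (h.tail_lt_cfLeft_iff (by omega) hagree hfne)⟩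

theorem boundaryCondition (h : IsCF ξ a d r) (hB : B < 3) (hN : (9 / 16 : ℝ) ^ N < 3 - B)
    (hK : ∀ k, K ≤ k → cfValue d r k < B) :
    BoundaryCondition (fun k => decide (d k = 2)) N (K + N + 2) := by
  have hK3 : ∀ k, K ≤ k → cfValue d r k < 3 := fun k hk => (hK k hk).trans hB
  have hdigit : ∀ k, K ≤ k → d k = 1 ∨ d k = 2 := fun k hk => h.digit_eq_one_or_two (hK3 k hk)
  have hdecide : ∀ {k l}, K ≤ k → K ≤ l → (decide (d k = 2) = decide (d l = 2) ↔ d k = d l) := by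
    intro k l hk hl
    have := hdigit k hk
    have := hdigit l hl
    rw [decide_eq_decide]
    omega
  refine ⟨fun i hi hne => ?_, fun i hi h0 h1 h2 => ?_⟩
  · rw [ne_eq, hdecide (by omega) (by omega)] at hne
    exact (hdecide (by omega) (by omega)).2 (h.no_isolated_digit hK3 (by omega) hne)
  · obtain ⟨m, rfl⟩ : ∃ m, i = m + 1 := ⟨i - 1, by omega⟩
    simp only [Nat.add_sub_cancel, add_assoc, Nat.reduceAdd, ne_eq] at h0 h1 h2
    rw [hdecide (by omega) (by omega)] at h0 h1 h2
    obtain ⟨f, hf, hagree, hne, hiff⟩ :=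
      h.exists_first_difference_at_boundary hB hN hK (by omega : K + N + 1 ≤ m) h0 h1 h2
    have := hdigit m (by omega)
    have := hdigit (m + 2) (by omega)
    have := hdigit (m - 1 - f) (by omega)
    have := hdigit (m + 4 + f) (by omega)
    simp only [show m + 1 + 1 = m + 2 by omega, show ∀ j, m + 1 - 2 - j = m - 1 - j by omega,
      show ∀ j, m + 1 + 3 + j = m + 4 + j by omega]
    refine ⟨f, hf, fun j hj => (hdecide (by omega) (by omega)).2 (hagree j hj), fun heven => ?_,
      fun hodd => ?_⟩
    · simp only [heven, true_iff] at hiff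
      exact ⟨(hdecide (by omega) (by omega)).2 (by omega),
        (hdecide (by omega) (by omega)).2 (by omega)⟩
    · simp only [hodd, false_iff] at hiff
      exact ⟨(hdecide (by omega) (by omega)).2 (by omega),
        (hdecide (by omega) (by omega)).2 (by omega)⟩

end BoundedBelowThree

theorem eventuallyPeriodic (h : IsCF ξ a d r) (hlt : bestConstant ξ < 3) :
    EventuallyPeriodic d := by
  obtain ⟨B, hconst, hB3⟩ := EReal.lt_iff_exists_real_btwn.1 hlt
  have hB : B < 3 := EReal.coe_lt_coe_iff.1 hB3
  rw [h.bestConstant_eq_limsup] at hconst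
  obtain ⟨K, hK⟩ := eventually_atTop.1 (eventually_lt_of_limsup_lt hconst)
  have hvalue : ∀ k, K ≤ k → cfValue d r k < B := fun k hk => EReal.coe_lt_coe_iff.1 (hK k hk)
  have hdigit : ∀ k, K ≤ k → d k = 1 ∨ d k = 2 := fun k hk =>
    h.digit_eq_one_or_two ((hvalue k hk).trans hB)
  obtain ⟨N, hN⟩ := exists_pow_lt_of_lt_one (sub_pos.2 hB) (by norm_num : (9 / 16 : ℝ) < 1)
  obtain ⟨M, p, hp, hper⟩ := (h.boundaryCondition hB hN hvalue).eventuallyPeriodic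
  refine ⟨max M K, p, hp, fun i hi => ?_⟩
  have hi' := hper i (le_of_max_le_left hi)
  rw [decide_eq_decide] at hi'
  have := hdigit i (le_of_max_le_right hi)
  have := hdigit (i + p) (by have := le_of_max_le_right hi; omega)
  omega

end IsCF

theorem countable_lagrangeSpectrum_inter_Iio_three : (lagrangeSpectrum ∩ Iio 3).Countable := by
  let S : Set ℝ := {ξ | ∃ a d r, IsCF ξ a d r ∧ EventuallyPeriodic d}
  have hS : S.Countable := by
    choose! a d r hcf using fun (ξ : ℝ) (hξ : ξ ∈ S) => hξ
    refine MapsTo.countable_of_injOn (f := fun ξ => (a ξ, d ξ))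
      (t := univ ×ˢ {w : ℕ → ℕ | EventuallyPeriodic w}) (fun ξ hξ => ⟨mem_univ _, (hcf ξ hξ).2⟩)
      (fun ξ hξ ξ' hξ' heq => ?_) (countable_univ.prod (countable_eventuallyPeriodic ℕ))
    obtain ⟨ha, hd⟩ := Prod.mk.inj heq
    have hcf' := (hcf ξ' hξ').1
    rw [← ha, ← hd] at hcf'
    exact (hcf ξ hξ).1.eq_of_digits hcf'
  refine (hS.image fun ξ => (bestConstant ξ).toReal).mono ?_
  rintro x ⟨⟨ξ, hξ, hx⟩, hlt⟩
  obtain ⟨a, d, r, hcf⟩ := exists_isCF_of_irrational hξ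
  refine ⟨ξ, ⟨a, d, r, hcf, hcf.eventuallyPeriodic ?_⟩, by simp [hx]⟩
  rw [hx]
  exact EReal.coe_lt_coe_iff.2 hlt

theorem lagrangeDim_three : lagrangeDim 3 = 0 := by
  rw [lagrangeDim, countable_lagrangeSpectrum_inter_Iio_three.dimH_zero, ENNReal.toReal_zero]

/-! ### Continued fractions with runs of digits `1` -/

/-- The map `u ↦ [0; 1, 1 + u]`, which prepends the digits `1, 1`. -/
noncomputable def onesMap (u : ℝ) : ℝ := 1 / (1 + 1 / (1 + u))

/-- The map `u ↦ [0; 2, 2 + u]`, which prepends the digits `2, 2`. -/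
noncomputable def twosMap (u : ℝ) : ℝ := 1 / (2 + 1 / (2 + u))

/-- The map `u ↦ [0; 1, …, 1, 2, 2 + u]`, which prepends a run of `2 k` digits `1` and the
digits `2, 2`. -/
noncomputable def runMap (k : ℕ) (u : ℝ) : ℝ := onesMap^[k] (twosMap u)

/-- The number `2 + u + [0; 2 + v]`: the value of a continued fraction at one digit of a pair `2, 2`
whose neighbouring expansions are `u`, on the side of that digit, and `v`, on the other side. -/
noncomputable def pairValue (u v : ℝ) : ℝ := 2 + u + 1 / (2 + v)

section RunMap

variable {u v : ℝ}

theorem onesMap_eq (hu : 0 ≤ u) : onesMap u = 1 - 1 / (2 + u) := by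
  rw [onesMap]
  field_simp
  ring

theorem onesMap_mem (hu : u ∈ Icc (0 : ℝ) 1) : onesMap u ∈ Icc (1 / 2 : ℝ) 1 := by
  rw [onesMap_eq hu.1]
  have hle : 1 / (2 + u) ≤ 1 / 2 := one_div_le_one_div_of_le two_pos (by linarith [hu.1])
  have hnonneg : 0 ≤ 1 / (2 + u) := one_div_nonneg.2 (by linarith [hu.1])
  constructor <;> linarith

theorem onesMap_iterate_mem (hu : u ∈ Icc (0 : ℝ) 1) (k : ℕ) : onesMap^[k] u ∈ Icc (0 : ℝ) 1 :=
  MapsTo.iterate (fun _ hx => Icc_subset_Icc_left (by norm_num) (onesMap_mem hx)) k hu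

theorem one_div_two_add_mem (hu : u ∈ Icc (0 : ℝ) 1) : 1 / (2 + u) ∈ Icc (1 / 3 : ℝ) (1 / 2) :=
  ⟨one_div_le_one_div_of_le (by linarith [hu.1]) (by linarith [hu.2]),
    one_div_le_one_div_of_le two_pos (by linarith [hu.1])⟩

theorem twosMap_mem (hu : u ∈ Icc (0 : ℝ) 1) : twosMap u ∈ Icc (2 / 5 : ℝ) (3 / 7) := by
  have hinv := one_div_two_add_mem hu
  rw [twosMap, show (2 / 5 : ℝ) = 1 / (5 / 2) by norm_num,
    show (3 / 7 : ℝ) = 1 / (7 / 3) by norm_num]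
  exact ⟨one_div_le_one_div_of_le (by linarith [hinv.1]) (by linarith [hinv.2]),
    one_div_le_one_div_of_le (by norm_num) (by linarith [hinv.1])⟩

theorem twosMap_mem_unit (hu : u ∈ Icc (0 : ℝ) 1) : twosMap u ∈ Icc (0 : ℝ) 1 :=
  Icc_subset_Icc (by norm_num) (by norm_num) (twosMap_mem hu)

theorem runMap_mem (hu : u ∈ Icc (0 : ℝ) 1) (k : ℕ) : runMap k u ∈ Icc (0 : ℝ) 1 :=
  onesMap_iterate_mem (twosMap_mem_unit hu) k

theorem exists_one_div_two_add_sub (hu : u ∈ Icc (0 : ℝ) 1) (hv : v ∈ Icc (0 : ℝ) 1) :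
    ∃ c ∈ Icc (1 / 9 : ℝ) (1 / 4), 1 / (2 + v) - 1 / (2 + u) = c * (u - v) := by
  have hu' := one_div_two_add_mem hu
  have hv' := one_div_two_add_mem hv
  refine ⟨1 / (2 + v) * (1 / (2 + u)), ⟨?_, ?_⟩, ?_⟩
  · nlinarith [hu'.1, hv'.1]
  · nlinarith [hu'.1, hv'.1, hu'.2, hv'.2]
  · have hu0 := hu.1
    have hv0 := hv.1
    field_simp
    ring

theorem exists_onesMap_iterate_sub (hu : u ∈ Icc (0 : ℝ) 1) (hv : v ∈ Icc (0 : ℝ) 1) (k : ℕ) :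
    ∃ c ∈ Icc ((1 / 9 : ℝ) ^ k) ((1 / 4 : ℝ) ^ k),
      onesMap^[k] u - onesMap^[k] v = c * (u - v) := by
  induction k with
  | zero => exact ⟨1, by simp, by simp⟩
  | succ k ih =>
    obtain ⟨c, ⟨hc, hc'⟩, hsub⟩ := ih
    have huk := onesMap_iterate_mem hu k
    have hvk := onesMap_iterate_mem hv k
    obtain ⟨b, ⟨hb, hb'⟩, hstep⟩ := exists_one_div_two_add_sub huk hvk
    have hc0 : 0 ≤ c := le_trans (by positivity) hc
    refine ⟨c * b, ⟨?_, ?_⟩, ?_⟩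
    · rw [pow_succ]
      exact mul_le_mul hc hb (by norm_num) hc0
    · rw [pow_succ]
      exact mul_le_mul hc' hb' (by linarith) (by positivity)
    · rw [Function.iterate_succ_apply', Function.iterate_succ_apply', onesMap_eq huk.1,
        onesMap_eq hvk.1]
      linear_combination hstep + b * hsub

theorem exists_twosMap_sub (hu : u ∈ Icc (0 : ℝ) 1) (hv : v ∈ Icc (0 : ℝ) 1) :
    ∃ c ∈ Icc ((1 / 9 : ℝ) ^ 2) ((1 / 4 : ℝ) ^ 2), twosMap u - twosMap v = c * (u - v) := by
  have hinv : ∀ {x : ℝ}, x ∈ Icc (0 : ℝ) 1 → 1 / (2 + x) ∈ Icc (0 : ℝ) 1 := fun hx =>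
    Icc_subset_Icc (by norm_num) (by norm_num) (one_div_two_add_mem hx)
  obtain ⟨b, ⟨hb, hb'⟩, hinner⟩ := exists_one_div_two_add_sub hu hv
  obtain ⟨c, ⟨hc, hc'⟩, houter⟩ := exists_one_div_two_add_sub (hinv hv) (hinv hu)
  refine ⟨c * b, ⟨?_, ?_⟩, ?_⟩
  · rw [sq]
    exact mul_le_mul hc hb (by norm_num) (by linarith)
  · rw [sq]
    exact mul_le_mul hc' hb' (by linarith) (by norm_num)
  · rw [twosMap, twosMap]
    linear_combination houter + c * hinner

theorem exists_runMap_sub (hu : u ∈ Icc (0 : ℝ) 1) (hv : v ∈ Icc (0 : ℝ) 1) (k : ℕ) :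
    ∃ c ∈ Icc ((1 / 9 : ℝ) ^ (k + 2)) ((1 / 4 : ℝ) ^ (k + 2)),
      runMap k u - runMap k v = c * (u - v) := by
  obtain ⟨c, ⟨hc, hc'⟩, hones⟩ :=
    exists_onesMap_iterate_sub (twosMap_mem_unit hu) (twosMap_mem_unit hv) k
  obtain ⟨b, ⟨hb, hb'⟩, htwos⟩ := exists_twosMap_sub hu hv
  have hb0 : 0 ≤ b := le_trans (by positivity) hb
  have hc0 : 0 ≤ c := le_trans (by positivity) hc
  refine ⟨c * b, ⟨?_, ?_⟩, ?_⟩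
  · rw [pow_add]
    exact mul_le_mul hc hb (by positivity) hc0
  · rw [pow_add]
    exact mul_le_mul hc' hb' hb0 (by positivity)
  · rw [runMap, runMap, hones, htwos, mul_assoc]

theorem pow_mul_abs_sub_le_abs_runMap_sub (hu : u ∈ Icc (0 : ℝ) 1) (hv : v ∈ Icc (0 : ℝ) 1)
    (k : ℕ) : (1 / 9 : ℝ) ^ (k + 2) * |u - v| ≤ |runMap k u - runMap k v| := by
  obtain ⟨c, ⟨hc, -⟩, hsub⟩ := exists_runMap_sub hu hv k
  rw [hsub, abs_mul, abs_of_nonneg (le_trans (by positivity) hc)]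
  gcongr

theorem abs_runMap_sub_le (hu : u ∈ Icc (0 : ℝ) 1) (hv : v ∈ Icc (0 : ℝ) 1) (k : ℕ) :
    |runMap k u - runMap k v| ≤ 1 / 4 * |u - v| := by
  obtain ⟨c, ⟨hc, hc'⟩, hsub⟩ := exists_runMap_sub hu hv k
  rw [hsub, abs_mul, abs_of_nonneg (le_trans (by positivity) hc)]
  gcongr
  exact hc'.trans (pow_le_of_le_one (by norm_num) (by norm_num) (by omega))

theorem pow_le_abs_runMap_sub_of_lt (hu : u ∈ Icc (0 : ℝ) 1) (hv : v ∈ Icc (0 : ℝ) 1) {k m : ℕ}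
    (hkm : k < m) : (1 / 9 : ℝ) ^ (k + 2) ≤ |runMap k u - runMap m v| := by
  obtain ⟨j, rfl⟩ := Nat.exists_eq_add_of_lt hkm
  -- After `k` common pairs of digits `1`, one expansion continues with `2` and the other with `1`.
  have hone : onesMap^[j + 1] (twosMap v) ∈ Icc (1 / 2 : ℝ) 1 := by
    rw [Function.iterate_succ_apply']
    exact onesMap_mem (onesMap_iterate_mem (twosMap_mem_unit hv) j)
  have htwo := twosMap_mem hu
  obtain ⟨c, ⟨hc, -⟩, hsub⟩ := exists_onesMap_iterate_sub (twosMap_mem_unit hu)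
    (Icc_subset_Icc_left (by norm_num) hone) k
  have hc0 : 0 ≤ c := le_trans (by positivity) hc
  rw [runMap, runMap, add_assoc, Function.iterate_add_apply, hsub, abs_mul, abs_of_nonneg hc0,
    pow_add, abs_sub_comm]
  exact mul_le_mul hc (le_abs.2 (Or.inl (by linarith [hone.1, htwo.2]))) (by norm_num) hc0

end RunMap

theorem abs_sub_le_of_runMap_orbits {Z : ℕ → ℕ} {u v : ℕ → ℝ} (hu : ∀ l, u l ∈ Icc (0 : ℝ) 1)
    (hv : ∀ l, v l ∈ Icc (0 : ℝ) 1) {j : ℕ} (hu' : ∀ l < j, u l = runMap (Z l) (u (l + 1)))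
    (hv' : ∀ l < j, v l = runMap (Z l) (v (l + 1))) : |u 0 - v 0| ≤ (1 / 4 : ℝ) ^ j := by
  have hiter : ∀ m ≤ j, |u 0 - v 0| ≤ (1 / 4 : ℝ) ^ m * |u m - v m| := by
    intro m
    induction m with
    | zero => simp
    | succ m ih =>
      intro hm
      refine (ih (by omega)).trans ?_
      rw [pow_succ, mul_assoc, hu' m (by omega), hv' m (by omega)]
      gcongr
      exact abs_runMap_sub_le (hu _) (hv _) _
  refine (hiter j le_rfl).trans (mul_le_of_le_one_right (by positivity) ?_)
  rw [abs_le]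
  constructor <;> linarith [(hu j).1, (hu j).2, (hv j).1, (hv j).2]

theorem exists_pairValue_sub {u v u' v' : ℝ} (hv : v ∈ Icc (0 : ℝ) 1) (hv' : v' ∈ Icc (0 : ℝ) 1) :
    ∃ c ∈ Icc (1 / 9 : ℝ) (1 / 4),
      pairValue u v - pairValue u' v' = u - u' - c * (v - v') := by
  obtain ⟨c, hc, hsub⟩ := exists_one_div_two_add_sub hv hv'
  refine ⟨c, hc, ?_⟩
  rw [pairValue, pairValue]
  linear_combination -hsub

section GoldenRatio

open Real (goldenRatio)

theorem inv_goldenRatio_mem : goldenRatio⁻¹ ∈ Ioo (3 / 5 : ℝ) (31 / 50) := by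
  have hlo : (11 / 5 : ℝ) < √5 := Real.lt_sqrt_of_sq_lt (by norm_num)
  have hhi : √5 < (56 / 25 : ℝ) := (Real.sqrt_lt' (by norm_num)).2 (by norm_num)
  rw [Real.inv_goldenRatio, Real.goldenConj]
  constructor <;> linarith

theorem inv_goldenRatio_mem_unit : goldenRatio⁻¹ ∈ Icc (0 : ℝ) 1 := by
  have hmem := inv_goldenRatio_mem
  constructor <;> linarith [hmem.1, hmem.2]

theorem one_div_two_add_inv_goldenRatio : 1 / (2 + goldenRatio⁻¹) = 1 - goldenRatio⁻¹ := by
  have hne : 2 + goldenRatio⁻¹ ≠ 0 := by linarith [inv_goldenRatio_mem.1]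
  rw [div_eq_iff hne, Real.inv_goldenRatio]
  linear_combination Real.goldenConj_sq

theorem onesMap_iterate_inv_goldenRatio (k : ℕ) : onesMap^[k] goldenRatio⁻¹ = goldenRatio⁻¹ := by
  apply Function.iterate_fixed
  rw [onesMap_eq inv_goldenRatio_mem_unit.1, one_div_two_add_inv_goldenRatio, sub_sub_cancel]

theorem inv_goldenRatio_sub_runMap_mem {u : ℝ} (hu : u ∈ Icc (0 : ℝ) 1) (k : ℕ) :
    goldenRatio⁻¹ - runMap k u ∈
      Icc (17 / 100 * (1 / 9 : ℝ) ^ k) (22 / 100 * (1 / 4 : ℝ) ^ k) := by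
  obtain ⟨c, ⟨hc, hc'⟩, hsub⟩ :=
    exists_onesMap_iterate_sub inv_goldenRatio_mem_unit (twosMap_mem_unit hu) k
  have hg := inv_goldenRatio_mem
  have htwo := twosMap_mem hu
  rw [onesMap_iterate_inv_goldenRatio] at hsub
  rw [runMap, hsub, mul_comm c]
  constructor
  · exact mul_le_mul (by linarith [hg.1, htwo.2]) hc (by positivity) (by linarith [hg.1, htwo.2])
  · exact mul_le_mul (by linarith [hg.2, htwo.1]) hc' (le_trans (by positivity) hc) (by norm_num)

/-- The constant `3` is the value of `pairValue` at the fixed point `φ⁻¹` of `onesMap`. -/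
theorem exists_pairValue_eq_three_sub {x y : ℝ} (hy : y ∈ Icc (0 : ℝ) 1) :
    ∃ c ∈ Icc (1 / 9 : ℝ) (1 / 4),
      pairValue x y = 3 - (goldenRatio⁻¹ - x) + c * (goldenRatio⁻¹ - y) := by
  obtain ⟨c, hc, hsub⟩ :=
    exists_pairValue_sub (u := x) (u' := goldenRatio⁻¹) hy inv_goldenRatio_mem_unit
  refine ⟨c, hc, ?_⟩
  have hthree : pairValue goldenRatio⁻¹ goldenRatio⁻¹ = 3 := by
    rw [pairValue, one_div_two_add_inv_goldenRatio]
    ring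
  linear_combination hsub + hthree

end GoldenRatio

theorem one_fourth_pow_le {n k : ℕ} (hk : 2 * n + 3 ≤ k) :
    (1 / 4 : ℝ) ^ k ≤ 1 / 64 * (1 / 9 : ℝ) ^ n :=
  calc (1 / 4 : ℝ) ^ k ≤ (1 / 4 : ℝ) ^ (2 * n + 3) :=
        pow_le_pow_of_le_one (by norm_num) (by norm_num) hk
    _ = 1 / 64 * (1 / 16 : ℝ) ^ n := by rw [pow_add, pow_mul]; norm_num; ring
    _ ≤ 1 / 64 * (1 / 9 : ℝ) ^ n := by gcongr; norm_num

section PairValue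

variable {u v : ℝ} {n : ℕ}

theorem pairValue_runMap_le (hu : u ∈ Icc (0 : ℝ) 1) (hv : v ∈ Icc (0 : ℝ) 1) (k m : ℕ) :
    pairValue (runMap k u) (runMap m v) ≤ 3 + 11 / 200 * (1 / 4 : ℝ) ^ m := by
  obtain ⟨c, ⟨hc, hc'⟩, hexp⟩ :=
    exists_pairValue_eq_three_sub (x := runMap k u) (runMap_mem hv m)
  obtain ⟨hu', -⟩ := inv_goldenRatio_sub_runMap_mem hu k
  obtain ⟨-, hv'⟩ := inv_goldenRatio_sub_runMap_mem hv m
  have hpos : (0 : ℝ) ≤ 17 / 100 * (1 / 9 : ℝ) ^ k := by positivity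
  have hmul : c * (Real.goldenRatio⁻¹ - runMap m v) ≤ 1 / 4 * (22 / 100 * (1 / 4 : ℝ) ^ m) :=
    mul_le_mul_of_nonneg hc' hv' (by linarith) (by positivity)
  rw [hexp]
  linarith

theorem pairValue_runMap_lt (hu : u ∈ Icc (0 : ℝ) 1) (hv : v ∈ Icc (0 : ℝ) 1) (k m : ℕ) :
    pairValue (runMap k u) (runMap m v) < 3 + (1 / 4 : ℝ) ^ m := by
  have hpos : (0 : ℝ) < (1 / 4 : ℝ) ^ m := by positivity
  linarith [pairValue_runMap_le hu hv k m]

theorem pairValue_runMap_le_of_le (hu : u ∈ Icc (0 : ℝ) 1) (hv : v ∈ Icc (0 : ℝ) 1) (k : ℕ) {m : ℕ}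
    (hm : 2 * n + 3 ≤ m) :
    pairValue (runMap k u) (runMap m v) ≤ 3 + 1 / 1000 * (1 / 9 : ℝ) ^ n := by
  have hpos : (0 : ℝ) < (1 / 9 : ℝ) ^ n := by positivity
  linarith [pairValue_runMap_le hu hv k m, one_fourth_pow_le hm]

theorem le_pairValue_runMap (hu : u ∈ Icc (0 : ℝ) 1) (hv : v ∈ Icc (0 : ℝ) 1) {k : ℕ}
    (hk : 2 * n + 3 ≤ k) :
    3 + 1 / 100 * (1 / 9 : ℝ) ^ n ≤ pairValue (runMap k u) (runMap n v) := by
  obtain ⟨c, ⟨hc, -⟩, hexp⟩ := exists_pairValue_eq_three_sub (x := runMap k u) (runMap_mem hv n)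
  obtain ⟨-, hu'⟩ := inv_goldenRatio_sub_runMap_mem hu k
  obtain ⟨hv', -⟩ := inv_goldenRatio_sub_runMap_mem hv n
  have hpos : (0 : ℝ) < (1 / 9 : ℝ) ^ n := by positivity
  have hmul : 1 / 9 * (17 / 100 * (1 / 9 : ℝ) ^ n) ≤ c * (Real.goldenRatio⁻¹ - runMap n v) :=
    mul_le_mul hc hv' (by positivity) (by linarith)
  rw [hexp]
  linarith [one_fourth_pow_le hk]

end PairValue

/-- The starting positions of the blocks `1, …, 1, 2, 2`, the `i`-th one with `2 K i` digits `1`. -/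
def runStart (K : ℕ → ℕ) : ℕ → ℕ
  | 0 => 0
  | i + 1 => runStart K i + 2 * K i + 2

open Classical in
/-- The concatenation of the blocks `1, …, 1, 2, 2`, the `i`-th one with `2 K i` digits `1`. -/
noncomputable def runDigits (K : ℕ → ℕ) (k : ℕ) : ℕ :=
  if ∃ i, k = runStart K i + 2 * K i ∨ k = runStart K i + 2 * K i + 1 then 2 else 1

/-- The expansion `[0; 1, …, 1, 2, 2, 1, …]` that is read leftwards from the pair `2, 2` of block
`i`, starting with its run of `2 K i` digits `1`. -/
noncomputable def leftTail (K : ℕ → ℕ) (i : ℕ) : ℝ :=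
  cfLeft (runDigits K) (runStart K i + 2 * K i)

/-- The sequence `y` consists of the tails `y l = [0; 1, …, 1, 2, 2, 1, …, 1, 2, 2, …]` of a
continued fraction whose runs of digits `1` have lengths `2 K l, 2 K (l + 1), …`. -/
structure RunTails (K : ℕ → ℕ) (y : ℕ → ℝ) : Prop where
  mem : ∀ l, y l ∈ Icc (0 : ℝ) 1
  eq_runMap : ∀ l, y l = runMap (K l) (y (l + 1))

section RunDigits

variable (K : ℕ → ℕ)

theorem runStart_mono : Monotone (runStart K) :=
  monotone_nat_of_le_succ fun i => by simp only [runStart]; omega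

theorem le_runStart (i : ℕ) : i ≤ runStart K i := by
  induction i with
  | zero => simp
  | succ i ih => simp only [runStart]; omega

theorem one_le_runDigits (k : ℕ) : 1 ≤ runDigits K k := by
  rw [runDigits]
  split_ifs <;> norm_num

theorem runDigits_ones {i j : ℕ} (hj : j < 2 * K i) : runDigits K (runStart K i + j) = 1 := by
  rw [runDigits, if_neg]
  rintro ⟨i', h⟩
  rcases lt_trichotomy i' i with hlt | rfl | hgt
  · have := runStart_mono K (Nat.succ_le_of_lt hlt)
    simp only [runStart] at this
    omega
  · omega
  · have := runStart_mono K (Nat.succ_le_of_lt hgt)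
    simp only [runStart] at this
    omega

theorem runDigits_first (i : ℕ) : runDigits K (runStart K i + 2 * K i) = 2 :=
  if_pos ⟨i, Or.inl rfl⟩

theorem runDigits_second (i : ℕ) : runDigits K (runStart K i + 2 * K i + 1) = 2 :=
  if_pos ⟨i, Or.inr rfl⟩

end RunDigits

theorem cfLeft_add_ones {d : ℕ → ℕ} {p m : ℕ} (hp : ∀ j < 2 * m, d (p + j) = 1) :
    cfLeft d (p + 2 * m) = onesMap^[m] (cfLeft d p) := by
  induction m with
  | zero => rfl
  | succ m ih =>
    have hfirst := hp (2 * m) (by omega)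
    have hsecond := hp (2 * m + 1) (by omega)
    rw [← add_assoc] at hsecond
    rw [mul_add_one, ← add_assoc, Function.iterate_succ_apply', ← ih fun j hj => hp j (by omega)]
    simp only [cfLeft, hfirst, hsecond, onesMap, Nat.cast_one]

theorem leftTail_succ (K : ℕ → ℕ) (i : ℕ) :
    leftTail K (i + 1) = runMap (K (i + 1)) (leftTail K i) := by
  rw [leftTail, cfLeft_add_ones fun j hj => runDigits_ones K hj, runMap]
  simp only [leftTail, runStart, cfLeft, runDigits_first, runDigits_second, twosMap, Nat.cast_ofNat]

theorem cfValue_second (K : ℕ → ℕ) (r : ℕ → ℝ) (i : ℕ) :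
    cfValue (runDigits K) r (runStart K i + 2 * K i + 1) =
      pairValue (r (runStart K (i + 1))) (leftTail K i) := by
  simp only [cfValue, pairValue, leftTail, runStart, cfLeft, runDigits_first, runDigits_second,
    Nat.cast_ofNat]

namespace IsCF

variable {ξ : ℝ} {a : ℤ} {d K : ℕ → ℕ} {r : ℕ → ℝ}

theorem tail_mem (h : IsCF ξ a d r) (k : ℕ) : r k ∈ Icc (0 : ℝ) 1 := ⟨(h.pos k).le, (h.lt_one k).le⟩

theorem cfLeft_mem (h : IsCF ξ a d r) (k : ℕ) : cfLeft d k ∈ Icc (0 : ℝ) 1 :=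
  ⟨cfLeft_nonneg d k, h.cfLeft_le_one k⟩

theorem tail_eq (h : IsCF ξ a d r) (k : ℕ) : r k = 1 / (d k + r (k + 1)) :=
  eq_one_div_of_mul_eq_one_left (h.tail_mul k)

theorem tail_ones (h : IsCF ξ a d r) (m : ℕ) {p : ℕ} (hp : ∀ j < 2 * m, d (p + j) = 1) :
    r p = onesMap^[m] (r (p + 2 * m)) := by
  induction m generalizing p with
  | zero => rfl
  | succ m ih =>
    have hrest := ih (p := p + 2) fun j hj => by
      rw [add_assoc]
      exact hp (2 + j) (by omega)
    have hfirst : d p = 1 := hp 0 (by omega)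
    have hsecond := hp 1 (by omega)
    rw [mul_add_one, add_comm (2 * m), ← add_assoc, Function.iterate_succ_apply', ← hrest,
      h.tail_eq p, h.tail_eq (p + 1), hfirst, hsecond, onesMap, Nat.cast_one]

theorem tail_runStart (h : IsCF ξ a (runDigits K) r) (i : ℕ) :
    r (runStart K i) = runMap (K i) (r (runStart K (i + 1))) := by
  rw [h.tail_ones (K i) fun j hj => runDigits_ones K hj, runMap, h.tail_eq,
    h.tail_eq (runStart K i + 2 * K i + 1), runDigits_first, runDigits_second]
  rfl

theorem cfValue_first (h : IsCF ξ a (runDigits K) r) (i : ℕ) :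
    cfValue (runDigits K) r (runStart K i + 2 * K i) =
      pairValue (leftTail K i) (r (runStart K (i + 1))) := by
  rw [cfValue, runDigits_first, h.tail_eq (runStart K i + 2 * K i + 1), runDigits_second,
    pairValue, add_right_comm]
  rfl

theorem runTails (h : IsCF ξ a (runDigits K) r) : RunTails K fun i => r (runStart K i) :=
  ⟨fun _ => h.tail_mem _, h.tail_runStart⟩

end IsCF

theorem exists_isCF_runDigits (K : ℕ → ℕ) : ∃ r : ℕ → ℝ, IsCF (r 0) 0 (runDigits K) r :=
  exists_isCF_of_digits (one_le_runDigits K)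

theorem leftTail_mem (K : ℕ → ℕ) (i : ℕ) : leftTail K i ∈ Icc (0 : ℝ) 1 := by
  obtain ⟨r, hr⟩ := exists_isCF_runDigits K
  exact hr.cfLeft_mem _

theorem exists_runTails (K : ℕ → ℕ) : ∃ y, RunTails K y := by
  obtain ⟨r, hr⟩ := exists_isCF_runDigits K
  exact ⟨_, hr.runTails⟩

/-- The runs `Z j, …, Z 1, Z 0, Z 1, …, Z j` for `j = 0, 1, …`, concatenated. The `j`-th group
occupies the indices `j ^ 2, …, j ^ 2 + 2 j`, so its centre is `j ^ 2 + j`; of the two truncated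
subtractions one always vanishes. -/
def symmetricRuns (Z : ℕ → ℕ) (i : ℕ) : ℕ :=
  Z ((i - (i.sqrt * i.sqrt + i.sqrt)) + ((i.sqrt * i.sqrt + i.sqrt) - i))

section SymmetricRuns

variable {Z : ℕ → ℕ}

theorem symmetricRuns_add {j l : ℕ} (hl : l ≤ j) : symmetricRuns Z (j * j + j + l) = Z l := by
  have hsqrt : (j * j + j + l).sqrt = j := by
    rw [add_assoc]
    exact Nat.sqrt_add_eq j (by omega)
  rw [symmetricRuns, hsqrt]
  congr 1
  omega

theorem symmetricRuns_sub {j l : ℕ} (hl : l ≤ j) : symmetricRuns Z (j * j + j - l) = Z l := by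
  have hsqrt : (j * j + j - l).sqrt = j := by
    rw [Nat.add_sub_assoc hl]
    exact Nat.sqrt_add_eq j (by omega)
  rw [symmetricRuns, hsqrt]
  congr 1
  omega

theorem eventually_of_symmetricRuns {Q : ℕ → Prop} (hcenter : ∀ᶠ j in atTop, Q (j * j + j))
    (hoff : ∀ᶠ i in atTop, ∀ l, 1 ≤ l → symmetricRuns Z i = Z l → Q i) : ∀ᶠ i in atTop, Q i := by
  have hsqrt : Tendsto Nat.sqrt atTop atTop :=
    tendsto_atTop_atTop_of_monotone (fun _ _ => Nat.sqrt_le_sqrt)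
      fun j => ⟨j * j, (Nat.sqrt_eq j).ge⟩
  filter_upwards [hoff, hsqrt.eventually hcenter] with i hi hsqrt_i
  by_cases h : i = i.sqrt * i.sqrt + i.sqrt
  · rw [h]
    exact hsqrt_i
  · exact hi _ (by omega) rfl

end SymmetricRuns

theorem limsup_eq_of_tendsto_comp {ι κ E : Type*} [CompleteLinearOrder E] [DenselyOrdered E]
    [TopologicalSpace E] [OrderTopology E] {l : Filter ι} {l' : Filter κ} [l'.NeBot] {x : ι → E}
    {φ : κ → ι} {t : E} (hφ : Tendsto φ l' l) (ht : Tendsto (x ∘ φ) l' (𝓝 t))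
    (hle : ∀ B > t, ∀ᶠ i in l, x i ≤ B) : limsup x l = t := by
  refine le_antisymm (le_of_forall_gt_imp_ge_of_dense fun B hB => limsup_le_of_le
    (by isBoundedDefault) (hle B hB)) ?_
  rw [← ht.limsup_eq, limsup_comp]
  exact limsup_le_limsup_of_le hφ

theorem limsup_coe_eq_of_tendsto_comp {ι κ : Type*} {l : Filter ι} {l' : Filter κ} [l'.NeBot]
    {x : ι → ℝ} {φ : κ → ι} {t : ℝ} (hφ : Tendsto φ l' l) (ht : Tendsto (x ∘ φ) l' (𝓝 t))
    (hle : ∀ B > t, ∀ᶠ i in l, x i ≤ B) : limsup (fun i => (x i : EReal)) l = t := by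
  refine limsup_eq_of_tendsto_comp hφ (continuous_coe_real_ereal.continuousAt.tendsto.comp ht)
    fun B hB => ?_
  obtain ⟨b, htb, hbB⟩ := EReal.lt_iff_exists_real_btwn.1 hB
  filter_upwards [hle b (EReal.coe_lt_coe_iff.1 htb)] with i hi
  exact (EReal.coe_le_coe_iff.2 hi).trans hbB.le

theorem tendsto_pairValue {ι : Type*} {l : Filter ι} {f g : ι → ℝ} {u v : ℝ}
    (hf : Tendsto f l (𝓝 u)) (hg : Tendsto g l (𝓝 v)) (hv : 0 ≤ v) :
    Tendsto (fun i => pairValue (f i) (g i)) l (𝓝 (pairValue u v)) :=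
  (hf.const_add 2).add (tendsto_const_nhds.div (hg.const_add 2) (by positivity))

theorem tendsto_of_dist_le_pow {X : Type*} [PseudoMetricSpace X] {f : ℕ → X} {x : X} {q : ℝ}
    {p : ℕ} (hq0 : 0 ≤ q) (hq1 : q < 1) (hf : ∀ j, dist (f j) x ≤ q ^ (j - p)) :
    Tendsto f atTop (𝓝 x) := by
  rw [tendsto_iff_dist_tendsto_zero]
  exact squeeze_zero (fun _ => dist_nonneg) hf
    ((tendsto_pow_atTop_nhds_zero_of_lt_one hq0 hq1).comp (tendsto_sub_atTop_nat p))

theorem RunTails.tendsto_center {Z : ℕ → ℕ} {y R : ℕ → ℝ} (hR : RunTails (symmetricRuns Z) R)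
    (hy : RunTails Z y) (p : ℕ) : Tendsto (fun j => R (j * j + j + p)) atTop (𝓝 (y p)) := by
  refine tendsto_of_dist_le_pow (q := 1 / 4) (p := p) (by norm_num) (by norm_num) fun j => ?_
  refine abs_sub_le_of_runMap_orbits (Z := fun l => Z (p + l))
    (u := fun l => R (j * j + j + p + l)) (v := fun l => y (p + l))
    (fun l => hR.mem _) (fun l => hy.mem _) (fun l hl => ?_) fun l _ => hy.eq_runMap _
  have hrun : symmetricRuns Z (j * j + j + p + l) = Z (p + l) := by
    rw [add_assoc _ p, symmetricRuns_add (by omega)]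
  rw [hR.eq_runMap, hrun]
  rfl

theorem RunTails.tendsto_leftTail_center {Z : ℕ → ℕ} {y : ℕ → ℝ} (hy : RunTails Z y) (p : ℕ) :
    Tendsto (fun j => leftTail (symmetricRuns Z) (j * j + j - p)) atTop (𝓝 (y p)) := by
  refine tendsto_of_dist_le_pow (q := 1 / 4) (p := p) (by norm_num) (by norm_num) fun j => ?_
  refine abs_sub_le_of_runMap_orbits (Z := fun l => Z (p + l))
    (u := fun l => leftTail (symmetricRuns Z) (j * j + j - p - l)) (v := fun l => y (p + l))
    (fun l => leftTail_mem _ _) (fun l => hy.mem _) (fun l hl => ?_) fun l _ => hy.eq_runMap _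
  have hpred : j * j + j - p - l = j * j + j - p - (l + 1) + 1 := by omega
  have hrun : symmetricRuns Z (j * j + j - p - l) = Z (p + l) := by
    rw [Nat.sub_sub, symmetricRuns_sub (by omega)]
  rw [hpred, leftTail_succ, ← hpred, hrun]

theorem IsCF.eventually_cfValue_le {ξ : ℝ} {a : ℤ} {K : ℕ → ℕ} {r : ℕ → ℝ}
    (h : IsCF ξ a (runDigits K) r) {B : ℝ} (hB : 3 ≤ B)
    (hfirst : ∀ᶠ i in atTop, pairValue (leftTail K i) (r (runStart K (i + 1))) ≤ B)
    (hsecond : ∀ᶠ i in atTop, pairValue (r (runStart K (i + 1))) (leftTail K i) ≤ B) :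
    ∀ᶠ k in atTop, cfValue (runDigits K) r k ≤ B := by
  obtain ⟨I, hI⟩ := eventually_atTop.1 (hfirst.and hsecond)
  filter_upwards [eventually_ge_atTop (runStart K I)] with k hk
  have hblock : ∀ i, k < runStart K (i + 1) → I ≤ i := fun i hi => by
    by_contra! hlt
    exact (hk.trans_lt hi).not_ge (runStart_mono K hlt)
  by_cases htwo : ∃ i, k = runStart K i + 2 * K i ∨ k = runStart K i + 2 * K i + 1
  · obtain ⟨i, rfl | rfl⟩ := htwo
    · rw [h.cfValue_first]
      have hlt : runStart K i + 2 * K i < runStart K (i + 1) := by simp only [runStart]; omega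
      exact (hI i (hblock i hlt)).1
    · rw [cfValue_second]
      have hlt : runStart K i + 2 * K i + 1 < runStart K (i + 1) := by simp only [runStart]; omega
      exact (hI i (hblock i hlt)).2
  · rw [cfValue, runDigits, if_neg htwo, Nat.cast_one]
    linarith [h.lt_one (k + 1), h.cfLeft_le_one k]

section Membership

variable {Z : ℕ → ℕ} {y : ℕ → ℝ}

theorem RunTails.le_pairValue (hy : RunTails Z y) (hZ : 2 * Z 0 + 3 ≤ Z 1) :
    3 + 1 / 100 * (1 / 9 : ℝ) ^ Z 0 ≤ pairValue (y 1) (y 0) := by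
  have hle := le_pairValue_runMap (hy.mem 2) (hy.mem 1) hZ
  rwa [← hy.eq_runMap 1, ← hy.eq_runMap 0] at hle

/-- Away from the centres the run on the far side of the pair `2, 2` is long, which keeps both
values at the pair below the limit of the values at the centres. -/
theorem RunTails.eventually_pairValue_le {R : ℕ → ℝ} (hR : RunTails (symmetricRuns Z) R)
    (hy : RunTails Z y) (hZ : ∀ l, 1 ≤ l → 2 * Z 0 + 3 ≤ Z l) {B : ℝ}
    (hB : pairValue (y 1) (y 0) < B) :
    (∀ᶠ i in atTop, pairValue (leftTail (symmetricRuns Z) (i - 1)) (R i) ≤ B) ∧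
      ∀ᶠ i in atTop, pairValue (R (i + 1)) (leftTail (symmetricRuns Z) i) ≤ B := by
  have hpos : (0 : ℝ) < (1 / 9 : ℝ) ^ Z 0 := by positivity
  have hlow := hy.le_pairValue (hZ 1 le_rfl)
  constructor
  · refine eventually_of_symmetricRuns (Z := Z) ?_ ?_
    · exact (tendsto_pairValue (hy.tendsto_leftTail_center 1) (hR.tendsto_center hy 0)
        (hy.mem 0).1).eventually_le_const hB
    · filter_upwards [eventually_ge_atTop 2] with i hi l hl hil
      obtain ⟨i, rfl⟩ := Nat.exists_eq_add_of_le' hi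
      rw [show i + 2 - 1 = i + 1 from rfl, leftTail_succ, hR.eq_runMap (i + 2), hil]
      linarith [pairValue_runMap_le_of_le (leftTail_mem (symmetricRuns Z) i) (hR.mem (i + 2 + 1))
        (symmetricRuns Z (i + 1)) (hZ l hl)]
  · refine eventually_of_symmetricRuns (Z := Z) ?_ ?_
    · exact (tendsto_pairValue (hR.tendsto_center hy 1) (hy.tendsto_leftTail_center 0)
        (hy.mem 0).1).eventually_le_const hB
    · filter_upwards [eventually_ge_atTop 1] with i hi l hl hil
      obtain ⟨i, rfl⟩ := Nat.exists_eq_add_of_le' hi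
      rw [leftTail_succ, hR.eq_runMap, hil]
      linarith [pairValue_runMap_le_of_le (hR.mem (i + 1 + 1 + 1))
        (leftTail_mem (symmetricRuns Z) i) (symmetricRuns Z (i + 1 + 1)) (hZ l hl)]

theorem RunTails.pairValue_mem_lagrangeSpectrum (hy : RunTails Z y)
    (hZ : ∀ l, 1 ≤ l → 2 * Z 0 + 3 ≤ Z l) : pairValue (y 1) (y 0) ∈ lagrangeSpectrum := by
  obtain ⟨r, h⟩ := exists_isCF_runDigits (symmetricRuns Z)
  have hpos : (0 : ℝ) < (1 / 9 : ℝ) ^ Z 0 := by positivity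
  have hlow := hy.le_pairValue (hZ 1 le_rfl)
  let mark : ℕ → ℕ := fun j => runStart (symmetricRuns Z) (j * j + j) +
    2 * symmetricRuns Z (j * j + j) + 1
  have hmark : Tendsto mark atTop atTop := tendsto_atTop_mono (fun j => by
    have := le_runStart (symmetricRuns Z) (j * j + j)
    simp only [mark, id]
    omega) tendsto_id
  refine ⟨r 0, h.irrational, h.bestConstant_eq_limsup.trans ?_⟩
  refine limsup_coe_eq_of_tendsto_comp hmark ?_ fun B hB => ?_
  · refine (tendsto_pairValue (h.runTails.tendsto_center hy 1) (hy.tendsto_leftTail_center 0)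
      (hy.mem 0).1).congr fun j => ?_
    exact (cfValue_second _ _ _).symm
  · obtain ⟨hfirst, hsecond⟩ := h.runTails.eventually_pairValue_le hy hZ hB
    exact h.eventually_cfValue_le (by linarith) ((tendsto_add_atTop_nat 1).eventually hfirst)
      hsecond

end Membership

/-! ### Lower bound for the dimension above `3` -/

theorem dimH_range_le_of_edist_le {A X Y : Type*} [EMetricSpace X] [EMetricSpace Y]
    {s : A → X} {f : A → Y} {C ρ : ℝ≥0} (hρ : 0 < ρ)
    (h : ∀ a b, edist (f a) (f b) ≤ C * edist (s a) (s b) ^ (ρ : ℝ)) :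
    dimH (range f) ≤ dimH (range s) / ρ := by
  rcases isEmpty_or_nonempty A with _ | _
  · simp [range_eq_empty]
  have hfactor : ∀ a, f (Function.invFun s (s a)) = f a := fun a => by
    refine edist_le_zero.1 ((h _ _).trans ?_)
    rw [Function.invFun_eq (f := s) ⟨a, rfl⟩, edist_self,
      ENNReal.zero_rpow_of_pos (by exact_mod_cast hρ), mul_zero]
  have hholder : HolderOnWith C ρ (f ∘ Function.invFun s) (range s) := by
    rintro _ ⟨a, rfl⟩ _ ⟨b, rfl⟩
    simp only [Function.comp_apply, hfactor]
    exact h a b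
  have himage : (f ∘ Function.invFun s) '' range s = range f := by
    rw [← range_comp]
    exact congrArg range (funext hfactor)
  exact himage ▸ hholder.dimH_image_le hρ

theorem Ico_subset_range_ofDigits {b : ℕ} (hb : 1 < b) :
    Ico (0 : ℝ) 1 ⊆ range (Real.ofDigits : (ℕ → Fin b) → ℝ) := fun x hx => by
  have : NeZero b := ⟨by omega⟩
  exact ⟨Real.digits x b, Real.ofDigits_digits hb hx⟩

theorem dimH_range_ofDigits {b : ℕ} (hb : 1 < b) :
    dimH (range (Real.ofDigits : (ℕ → Fin b) → ℝ)) = 1 := by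
  refine le_antisymm (dimH_real_le_one _) ?_
  have hIco : dimH (Ico (0 : ℝ) 1) = 1 := by
    rw [Real.dimH_of_nonempty_interior (by simp), Module.finrank_self, Nat.cast_one]
  exact hIco ▸ dimH_mono (Ico_subset_range_ofDigits hb)

theorem log_div_log_le_dimH_range {X : Type*} [MetricSpace X] {b : ℕ} (hb : 1 < b) {δ : ℝ}
    (hδ0 : 0 < δ) (hδ1 : δ < 1) {t : (ℕ → Fin b) → X}
    (ht : ∀ j x x', (∀ l < j, x l = x' l) → x j ≠ x' j → δ ^ (j + 1) ≤ dist (t x) (t x')) :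
    ENNReal.ofReal (Real.log b / Real.log (1 / δ)) ≤ dimH (range t) := by
  have hb1 : (1 : ℝ) < b := by exact_mod_cast hb
  have hlogb : 0 < Real.log b := Real.log_pos hb1
  have hlogδ : 0 < Real.log (1 / δ) := Real.log_pos ((one_lt_div hδ0).2 hδ1)
  set ρ : ℝ≥0 := (Real.log b / Real.log (1 / δ)).toNNReal with hρ
  have hρ0 : 0 < ρ := Real.toNNReal_pos.2 (div_pos hlogb hlogδ)
  have hscale : δ ^ (ρ : ℝ) = (b : ℝ)⁻¹ := by
    rw [hρ, Real.coe_toNNReal _ (div_pos hlogb hlogδ).le, one_div, Real.log_inv, div_neg,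
      Real.rpow_neg hδ0.le, Real.log_div_log, Real.rpow_logb hδ0 hδ1.ne (by linarith)]
  have hholder : ∀ x x', edist (Real.ofDigits x) (Real.ofDigits x') ≤
      (b : ℝ≥0) * edist (t x) (t x') ^ (ρ : ℝ) := by
    intro x x'
    rcases eq_or_ne x x' with rfl | hne
    · simp
    set j := PiNat.firstDiff x x'
    have hdigits := Real.abs_ofDigits_sub_ofDigits_le fun i hi =>
      PiNat.apply_eq_of_lt_firstDiff (n := i) (x := x) (y := x') hi
    have hfar := Real.rpow_le_rpow (by positivity)
      (ht j x x' (fun _ => PiNat.apply_eq_of_lt_firstDiff) (PiNat.apply_firstDiff_ne hne))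
      ρ.coe_nonneg
    rw [← Real.rpow_pow_comm hδ0.le, hscale] at hfar
    rw [edist_dist, edist_dist, ENNReal.ofReal_rpow_of_nonneg dist_nonneg ρ.coe_nonneg,
      ← ENNReal.ofReal_coe_nnreal, ← ENNReal.ofReal_mul (NNReal.coe_nonneg _)]
    refine ENNReal.ofReal_le_ofReal (hdigits.trans ?_)
    calc ((b : ℝ) ^ j)⁻¹ = b * (b : ℝ)⁻¹ ^ (j + 1) := by
          rw [inv_pow, pow_succ]
          field_simp
      _ ≤ b * dist (t x) (t x') ^ (ρ : ℝ) := by gcongr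
  have hdim := dimH_range_le_of_edist_le hρ0 hholder
  rw [dimH_range_ofDigits hb, ENNReal.le_div_iff_mul_le (Or.inl (by exact_mod_cast hρ0.ne'))
    (Or.inl ENNReal.coe_ne_top), one_mul] at hdim
  exact hdim

theorem RunTails.shift {Z : ℕ → ℕ} {y : ℕ → ℝ} (hy : RunTails Z y) :
    RunTails (fun l => Z (l + 1)) fun l => y (l + 1) :=
  ⟨fun l => hy.mem (l + 1), fun l => hy.eq_runMap (l + 1)⟩

theorem RunTails.pow_le_abs_sub {N j : ℕ} {Z Z' : ℕ → ℕ} {y y' : ℕ → ℝ} (hy : RunTails Z y)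
    (hy' : RunTails Z' y') (hZ : ∀ l, Z l ≤ N) (heq : ∀ l < j, Z l = Z' l) (hne : Z j ≠ Z' j) :
    ((1 / 9 : ℝ) ^ (N + 2)) ^ (j + 1) ≤ |y 0 - y' 0| := by
  have hpow : ∀ {k}, k ≤ N → (1 / 9 : ℝ) ^ (N + 2) ≤ (1 / 9 : ℝ) ^ (k + 2) := fun hk =>
    pow_le_pow_of_le_one (by norm_num) (by norm_num) (by omega)
  induction j generalizing Z Z' y y' with
  | zero =>
    rw [pow_one, hy.eq_runMap, hy'.eq_runMap]
    rcases hne.lt_or_gt with hlt | hlt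
    · exact (hpow (hZ 0)).trans (pow_le_abs_runMap_sub_of_lt (hy.mem _) (hy'.mem _) hlt)
    · rw [abs_sub_comm]
      exact (hpow (hlt.le.trans (hZ 0))).trans
        (pow_le_abs_runMap_sub_of_lt (hy'.mem _) (hy.mem _) hlt)
  | succ j ih =>
    have hrec := ih hy.shift hy'.shift (fun l => hZ (l + 1)) (fun l hl => heq (l + 1) (by omega))
      hne
    rw [pow_succ', hy.eq_runMap, hy'.eq_runMap, ← heq 0 (by omega)]
    refine le_trans ?_ (pow_mul_abs_sub_le_abs_runMap_sub (hy.mem _) (hy'.mem _) _)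
    exact mul_le_mul (hpow (hZ 0)) hrec (by positivity) (by positivity)

theorem abs_sub_le_abs_pairValue_runMap_sub {u v : ℝ} (hu : u ∈ Icc (0 : ℝ) 1)
    (hv : v ∈ Icc (0 : ℝ) 1) (n : ℕ) :
    1 / 9 * |u - v| ≤ |pairValue u (runMap n u) - pairValue v (runMap n v)| := by
  obtain ⟨c, ⟨hc, hc'⟩, hsub⟩ :=
    exists_pairValue_sub (u := u) (u' := v) (runMap_mem hu n) (runMap_mem hv n)
  have hmul : |c * (runMap n u - runMap n v)| ≤ 1 / 4 * (1 / 4 * |u - v|) := by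
    rw [abs_mul, abs_of_nonneg (by linarith)]
    exact mul_le_mul hc' (abs_runMap_sub_le hu hv n) (abs_nonneg _) (by norm_num)
  rw [hsub]
  linarith [abs_sub_abs_le_abs_sub (u - v) (c * (runMap n u - runMap n v)), abs_nonneg (u - v)]

/-- The runs used for the lower bound on the dimension: the marked run `n`, followed by runs
`2 n + 3` and `2 n + 4` coding the binary sequence `x`. -/
def markedRuns (n : ℕ) (x : ℕ → Fin 2) : ℕ → ℕ
  | 0 => n
  | l + 1 => 2 * n + 3 + x l

theorem pow_le_abs_sub_of_markedRuns {n j : ℕ} {x x' : ℕ → Fin 2} {y y' : ℕ → ℝ}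
    (hy : RunTails (markedRuns n x) y) (hy' : RunTails (markedRuns n x') y')
    (heq : ∀ l < j, x l = x' l) (hne : x j ≠ x' j) :
    ((1 / 9 : ℝ) ^ (2 * n + 7)) ^ (j + 1) ≤ |pairValue (y 1) (y 0) - pairValue (y' 1) (y' 0)| := by
  have htails : ((1 / 9 : ℝ) ^ (2 * n + 4 + 2)) ^ (j + 1) ≤ |y 1 - y' 1| := by
    refine hy.shift.pow_le_abs_sub hy'.shift (fun l => ?_) (fun l hl => ?_) ?_
    · simp only [markedRuns]
      omega
    · simp only [markedRuns, heq l hl]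
    · simpa only [markedRuns, ne_eq, Nat.add_left_cancel_iff, Fin.val_inj] using hne
  rw [hy.eq_runMap 0, hy'.eq_runMap 0]
  refine le_trans ?_ (abs_sub_le_abs_pairValue_runMap_sub (hy.mem 1) (hy'.mem 1) n)
  calc ((1 / 9 : ℝ) ^ (2 * n + 7)) ^ (j + 1)
      = (1 / 9) ^ (j + 1) * ((1 / 9 : ℝ) ^ (2 * n + 4 + 2)) ^ (j + 1) := by
        rw [← mul_pow, ← pow_succ']
    _ ≤ 1 / 9 * |y 1 - y' 1| := by
        gcongr
        exact pow_le_of_le_one (by norm_num) (by norm_num) (by omega)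

theorem pairValue_mem_lagrangeSpectrum_inter_Iio {n : ℕ} {x : ℕ → Fin 2} {y : ℕ → ℝ}
    (hy : RunTails (markedRuns n x) y) :
    pairValue (y 1) (y 0) ∈ lagrangeSpectrum ∩ Iio (3 + (1 / 4 : ℝ) ^ n) := by
  refine ⟨hy.pairValue_mem_lagrangeSpectrum fun l hl => ?_, ?_⟩
  · obtain ⟨l, rfl⟩ := Nat.exists_eq_add_of_le' hl
    simp only [markedRuns]
    omega
  · have hlt := pairValue_runMap_lt (hy.mem 2) (hy.mem 1) (markedRuns n x 1) n
    rw [← hy.eq_runMap 1] at hlt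
    rwa [hy.eq_runMap 0]

theorem log_div_le_lagrangeDim (n : ℕ) :
    Real.log 2 / ((2 * n + 7) * Real.log 9) ≤ lagrangeDim (3 + (1 / 4 : ℝ) ^ n) := by
  choose y hy using fun x => exists_runTails (markedRuns n x)
  have hdim := log_div_log_le_dimH_range one_lt_two (δ := (1 / 9 : ℝ) ^ (2 * n + 7))
    (t := fun x => pairValue (y x 1) (y x 0))
    (by positivity) (pow_lt_one₀ (by norm_num) (by norm_num) (by omega))
    fun j x x' heq hne => pow_le_abs_sub_of_markedRuns (hy x) (hy x') heq hne
  have hlog : Real.log (1 / (1 / 9 : ℝ) ^ (2 * n + 7)) = (2 * n + 7) * Real.log 9 := by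
    rw [← one_div_pow, one_div_one_div, Real.log_pow]
    push_cast
    rfl
  rw [hlog, Nat.cast_ofNat] at hdim
  refine (ENNReal.ofReal_le_iff_le_toReal
    ((dimH_real_le_one _).trans_lt ENNReal.one_lt_top).ne).1 (hdim.trans (dimH_mono ?_))
  rintro _ ⟨x, rfl⟩
  exact pairValue_mem_lagrangeSpectrum_inter_Iio (hy x)

theorem not_exists_holderWith_of_div_le {X Y : Type*} [PseudoMetricSpace X] [PseudoMetricSpace Y]
    {f : X → Y} {x : X} {u : ℕ → X} {c q : ℝ} {α : ℝ≥0} (hα : 0 < α) (hc : 0 < c) (hq0 : 0 ≤ q)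
    (hq1 : q < 1) (hu : ∀ n, dist (u n) x ≤ q ^ n)
    (hf : ∀ n : ℕ, c / (n + 1) ≤ dist (f (u n)) (f x)) : ¬ ∃ C : ℝ≥0, HolderWith C α f := by
  rintro ⟨C, hC⟩
  set p := q ^ (α : ℝ) with hp
  have hp0 : 0 ≤ p := Real.rpow_nonneg hq0 _
  have hp1 : p < 1 := Real.rpow_lt_one hq0 hq1 (by exact_mod_cast hα)
  have hbound : ∀ n : ℕ, c ≤ C * ((n : ℝ) ^ 1 * p ^ n + p ^ n) := fun n => by
    have hle : c / (n + 1) ≤ C * p ^ n := calc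
      c / (n + 1) ≤ C * dist (u n) x ^ (α : ℝ) := (hf n).trans (hC.dist_le _ _)
      _ ≤ C * (q ^ n) ^ (α : ℝ) := by gcongr; exact hu n
      _ = C * p ^ n := by rw [hp, Real.rpow_pow_comm hq0]
    rw [div_le_iff₀ (by positivity)] at hle
    linarith
  have hlim : Tendsto (fun n : ℕ => C * ((n : ℝ) ^ 1 * p ^ n + p ^ n)) atTop
      (𝓝 (C * (0 + 0))) :=
    ((tendsto_pow_const_mul_const_pow_of_abs_lt_one 1 (abs_lt.2 ⟨by linarith, hp1⟩)).add
      (tendsto_pow_atTop_nhds_zero_of_lt_one hp0 hp1)).const_mul _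
  rw [add_zero, mul_zero] at hlim
  exact (ge_of_tendsto' hlim hbound).not_gt hc

theorem mainTheorem6 (α : ℝ≥0) (hα : 0 < α) :
    ¬ ∃ C : ℝ≥0, HolderWith C α lagrangeDim := by
  have hlog2 : 0 < Real.log 2 := Real.log_pos (by norm_num)
  have hlog9 : 0 < Real.log 9 := Real.log_pos (by norm_num)
  refine not_exists_holderWith_of_div_le (x := 3) (u := fun n => 3 + (1 / 4 : ℝ) ^ n)
    (c := Real.log 2 / (7 * Real.log 9)) (q := 1 / 4) hα (by positivity) (by norm_num)
    (by norm_num) (fun n => ?_) fun n => ?_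
  · rw [dist_self_add_left, Real.norm_of_nonneg (by positivity)]
  · rw [lagrangeDim_three, dist_zero_right]
    calc Real.log 2 / (7 * Real.log 9) / (n + 1) ≤ Real.log 2 / ((2 * n + 7) * Real.log 9) := by
          rw [div_div]
          exact div_le_div_of_nonneg_left hlog2.le (by positivity) (by nlinarith)
      _ ≤ lagrangeDim (3 + (1 / 4 : ℝ) ^ n) := log_div_le_lagrangeDim n
      _ ≤ ‖lagrangeDim (3 + (1 / 4 : ℝ) ^ n)‖ := Real.le_norm_self _
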